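/- Let $G$ be a group with a filtration (N-series), i.e. a descending chain of subgroups $G=F_1G\supset F_2G\supset F_3G\supset\cdots$ with $[F_iG,F_jG]\subset F_{i+j}G$ for all $i,j\ge 1$. Filter the group algebra $\mathbb{Q}[G]$ by letting $F_n\mathbb{Q}[G]$ ($n\ge 0$) be the span of all products $(g_1-1)\cdots(g_r-1)$ with $r\ge 0$, $g_1\in F_{k_1}G,\dots,g_r\in F_{k_r}G$ and $k_1+\cdots+k_r\ge n$. Let $\widehat{\mathbb{Q}}[G]=\varprojlim_n\mathbb{Q}[G]/F_n\mathbb{Q}[G]$ be the completion, filtered by $F_j\widehat{\mathbb{Q}}[G]=\varprojlim_{i\ge j}F_j\mathbb{Q}[G]/F_i\mathbb{Q}[G]$, and let $\widehat\Delta:\widehat{\mathbb{Q}}[G]\to\widehat{\mathbb{Q}}[G]\,\widehat\otimes\,\widehat{\mathbb{Q}}[G]$ be induced by the coproduct of $\mathbb{Q}[G]$, where $\widehat\otimes$ is the completion of the tensor product with respect to the filtration $F_n=\sum_{i+j=n}F_i\otimes F_j$. The Malcev completion of the filtered group $G$ is the group of group-like elements $$\mathcal{G}(G)=\{x\in\widehat{\mathbb{Q}}[G]:\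 \widehat\Delta x=x\,\widehat\otimes\,x,\ x\ne 0\},$$ filtered by $F_i\mathcal{G}(G)=\mathcal{G}(G)\cap(1+F_i\widehat{\mathbb{Q}}[G])$ for $i\ge 1$, and $\iota:G\to\mathcal{G}(G)$ is the canonical map. A uniquely divisible closure of a nilpotent group $N$ is a nilpotent group $D$ in which every element has a unique $k$-th root for every $k\ge 1$, together with a homomorphism $N\to D$ whose kernel is the torsion subgroup of $N$ and such that every element of $D$ has a positive power in the image of $N$. Theorem. Each $G/F_iG$ has a uniquely divisible closure. Let $j_i:G/F_iG\to (G/F_iG)\otimes\mathbb{Q}$ be any choice of uniquely divisible closures, $i\ge 1$. Then the projections $G/F_kG\to G/F_iG$ ($k\ge i$) extend uniquely to homomorphisms $(G/F_kG)\otimes\mathbb{Q}\to(G/F_iG)\otimes\mathbb{Q}$; there are unique homomorphisms $\varphi_i:(G/F_iG)\otimes\mathbb{Q}\to\mathcal{G}(G)/F_i\mathcal{G}(G)$ with $\varphi_i(j_i(gF_iG))=\iota(g)F_i\mathcal{G}(G)$ for all $g\in G$; and there is a unique group isomorphism $$\Phi:\varprojlim_i\big((G/F_iG)\otimes\mathbb{Q}\big)\;\xrightarrow{\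 \simeq\ }\;\mathcal{G}(G)$$ induced by $\iota$, that is, such that $\Phi(x)F_i\mathcal{G}(G)=\varphi_i(x_i)$ for all $x=(x_i)_i$ and all $i\ge1$, and $\Phi\big((j_i(gF_iG))_i\big)=\iota(g)$ for all $g\in G$. -/

import Mathlib

universe u v

open scoped TensorProduct commutatorElement

noncomputable section

namespace Malcev

/-! ### Filtered algebras and their completions -/

/-- A descending filtration `A = F 0 ⊇ F 1 ⊇ F 2 ⊇ ⋯` of a `K`-algebra `A` by subspaces which is
compatible with the multiplication. -/
structure AlgFiltration (K A : Type*) [CommRing K] [Ring A] [Algebra K A] where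
  /-- the `n`-th term of the filtration -/
  term : ℕ → Submodule K A
  antitone : Antitone term
  term_zero : term 0 = ⊤
  mul_mem : ∀ {m n : ℕ} {a b : A}, a ∈ term m → b ∈ term n → a * b ∈ term (m + n)

namespace AlgFiltration

variable {K A B : Type*} [CommRing K] [Ring A] [Algebra K A] [Ring B] [Algebra K B]

/-- The terms of an algebra filtration are (two-sided) ideals. -/
def ideal (F : AlgFiltration K A) (n : ℕ) : Ideal A where
  carrier := F.term n
  add_mem' := (F.term n).add_mem
  zero_mem' := (F.term n).zero_mem
  smul_mem' c x hx := by
    have hc : c ∈ F.term 0 := by simp [F.term_zero]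
    simpa using F.mul_mem hc hx

theorem mem_ideal {F : AlgFiltration K A} {n : ℕ} {a : A} : a ∈ F.ideal n ↔ a ∈ F.term n :=
  Iff.rfl

instance (F : AlgFiltration K A) (n : ℕ) : (F.ideal n).IsTwoSided where
  mul_mem_of_left b ha := by
    have hb : b ∈ F.term 0 := by simp [F.term_zero]
    have h := F.mul_mem ha hb
    rwa [add_zero] at h

/-- The canonical projection `A / F n → A / F m` for `m ≤ n`. -/
def transition (F : AlgFiltration K A) {m n : ℕ} (h : m ≤ n) :
    (A ⧸ F.ideal n) →ₐ[K] (A ⧸ F.ideal m) :=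
  Ideal.Quotient.factorₐ K (fun _ hx => F.antitone h hx)

theorem transition_mk (F : AlgFiltration K A) {m n : ℕ} (h : m ≤ n) (a : A) :
    F.transition h (Ideal.Quotient.mkₐ K (F.ideal n) a) = Ideal.Quotient.mkₐ K (F.ideal m) a :=
  rfl

/-- The algebra of compatible families of elements of the quotients `A / F n`. -/
def compatibleFamilies (F : AlgFiltration K A) : Subalgebra K (∀ n, A ⧸ F.ideal n) where
  carrier := {x | ∀ (m n : ℕ) (h : m ≤ n), F.transition h (x n) = x m}
  mul_mem' hx hy m n h := by simp [hx m n h, hy m n h]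
  add_mem' hx hy m n h := by simp [hx m n h, hy m n h]
  algebraMap_mem' r m n h := by simp

/-- The completion `lim_n A / F n` of a filtered algebra: the algebra of compatible families. -/
def completion (F : AlgFiltration K A) : Type _ :=
  F.compatibleFamilies

instance (F : AlgFiltration K A) : Ring F.completion :=
  inferInstanceAs (Ring F.compatibleFamilies)

instance (F : AlgFiltration K A) : Algebra K F.completion :=
  inferInstanceAs (Algebra K F.compatibleFamilies)

/-- The canonical map from a filtered algebra to its completion. -/
def toCompletion (F : AlgFiltration K A) : A →ₐ[K] F.completion :=
  (AlgHom.pi fun n => Ideal.Quotient.mkₐ K (F.ideal n)).codRestrict F.compatibleFamilies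
    fun a _ _ h => F.transition_mk h a

/-- The projection of the completion to `A / F n`. -/
def proj (F : AlgFiltration K A) (n : ℕ) : F.completion →ₐ[K] (A ⧸ F.ideal n) :=
  (Pi.evalAlgHom K (fun n => A ⧸ F.ideal n) n).comp F.compatibleFamilies.val

theorem completion_ext {F : AlgFiltration K A} {x y : F.completion}
    (h : ∀ n, F.proj n x = F.proj n y) : x = y :=
  Subtype.ext (funext h)

theorem transition_proj (F : AlgFiltration K A) {m n : ℕ} (h : m ≤ n) (x : F.completion) :
    F.transition h (F.proj n x) = F.proj m x :=
  x.2 m n h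

theorem proj_toCompletion (F : AlgFiltration K A) (n : ℕ) (a : A) :
    F.proj n (F.toCompletion a) = Ideal.Quotient.mkₐ K (F.ideal n) a :=
  rfl

theorem mk_eq_zero {F : AlgFiltration K A} {n : ℕ} {a : A} :
    Ideal.Quotient.mkₐ K (F.ideal n) a = 0 ↔ a ∈ F.term n :=
  Ideal.Quotient.eq_zero_iff_mem

theorem mk_surjective (F : AlgFiltration K A) (n : ℕ) (x : A ⧸ F.ideal n) :
    ∃ a, Ideal.Quotient.mkₐ K (F.ideal n) a = x :=
  Ideal.Quotient.mk_surjective x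

/-- The filtration of the completion, `F_j (lim_i A / F i) := lim_{i ≥ j} F j / F i`: the families
all of whose components `x i`, `i ≥ j`, come from `F j`.  -/
def completionTerm (F : AlgFiltration K A) (j : ℕ) : Submodule K F.completion where
  carrier := {x | ∀ i, j ≤ i → ∃ a ∈ F.term j, Ideal.Quotient.mkₐ K (F.ideal i) a = F.proj i x}
  add_mem' {x y} hx hy i h := by
    obtain ⟨a, ha, hax⟩ := hx i h
    obtain ⟨b, hb, hby⟩ := hy i h
    exact ⟨a + b, (F.term j).add_mem ha hb, by rw [map_add, map_add, hax, hby]⟩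
  zero_mem' i _ := ⟨0, (F.term j).zero_mem, by rw [map_zero, map_zero]⟩
  smul_mem' c x hx i h := by
    obtain ⟨a, ha, hax⟩ := hx i h
    exact ⟨c • a, (F.term j).smul_mem c ha, by rw [map_smul, map_smul, hax]⟩

/-- The `j`-th term of the filtration of the completion is the kernel of the `j`-th projection. -/
theorem mem_completionTerm {F : AlgFiltration K A} {j : ℕ} {x : F.completion} :
    x ∈ F.completionTerm j ↔ F.proj j x = 0 := by
  constructor
  · intro hx
    obtain ⟨a, ha, hax⟩ := hx j le_rfl
    rw [← hax, mk_eq_zero]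
    exact ha
  · intro hx i h
    obtain ⟨a, ha⟩ := F.mk_surjective i (F.proj i x)
    refine ⟨a, ?_, ha⟩
    rw [← mk_eq_zero (F := F), ← F.transition_mk h, ha, F.transition_proj, hx]

/-- The filtration of the completion of a filtered algebra. -/
def completionFiltration (F : AlgFiltration K A) : AlgFiltration K F.completion where
  term := F.completionTerm
  antitone m n h x hx := by
    rw [mem_completionTerm] at hx ⊢
    rw [← F.transition_proj h, hx, map_zero]
  term_zero := by
    rw [eq_top_iff]
    intro x _
    rw [mem_completionTerm]
    obtain ⟨a, ha⟩ := F.mk_surjective 0 (F.proj 0 x)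
    rw [← ha, mk_eq_zero, F.term_zero]
    trivial
  mul_mem {m n x y} hx hy := by
    rw [mem_completionTerm]
    obtain ⟨a, ha, hax⟩ := hx (m + n) (Nat.le_add_right m n)
    obtain ⟨b, hb, hby⟩ := hy (m + n) (Nat.le_add_left n m)
    rw [map_mul, ← hax, ← hby, ← map_mul, mk_eq_zero]
    exact F.mul_mem ha hb

theorem toCompletion_mem {F : AlgFiltration K A} {n : ℕ} {a : A} (ha : a ∈ F.term n) :
    F.toCompletion a ∈ F.completionFiltration.term n :=
  mem_completionTerm.2 (mk_eq_zero.2 ha)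

/-- The `n`-th term `∑_{i+j=n} F i ⊗ F' j` of the filtration of a tensor product. -/
def tensorTerm (F : AlgFiltration K A) (F' : AlgFiltration K B) (n : ℕ) : Submodule K (A ⊗[K] B) :=
  ⨆ p : {p : ℕ × ℕ // p.1 + p.2 = n},
    Submodule.map₂ (TensorProduct.mk K A B) (F.term p.1.1) (F'.term p.1.2)

theorem tmul_mem_tensorTerm {F : AlgFiltration K A} {F' : AlgFiltration K B} {i j n : ℕ}
    (h : i + j = n) {a : A} {b : B} (ha : a ∈ F.term i) (hb : b ∈ F'.term j) :
    a ⊗ₜ[K] b ∈ tensorTerm F F' n :=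
  Submodule.mem_iSup_of_mem ⟨(i, j), h⟩ (Submodule.apply_mem_map₂ (TensorProduct.mk K A B) ha hb)

theorem tensorTerm_le {F : AlgFiltration K A} {F' : AlgFiltration K B} {n : ℕ}
    {P : Submodule K (A ⊗[K] B)}
    (h : ∀ i j, i + j = n → ∀ a ∈ F.term i, ∀ b ∈ F'.term j, a ⊗ₜ[K] b ∈ P) :
    tensorTerm F F' n ≤ P :=
  iSup_le fun p => Submodule.map₂_le.2 fun a ha b hb => h p.1.1 p.1.2 p.2 a ha b hb

/-- The filtration `F n (A ⊗ B) = ∑_{i+j=n} F i ⊗ F' j` of the tensor product of two filtered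
algebras. -/
def tensor (F : AlgFiltration K A) (F' : AlgFiltration K B) : AlgFiltration K (A ⊗[K] B) where
  term := tensorTerm F F'
  antitone := antitone_nat_of_succ_le fun n => tensorTerm_le fun i j h a ha b hb => by
    rcases i with _ | i
    · exact tmul_mem_tensorTerm (by omega : 0 + (j - 1) = n) ha (F'.antitone (by omega) hb)
    · exact tmul_mem_tensorTerm (by omega : i + j = n) (F.antitone (by omega) ha) hb
  term_zero := by
    rw [eq_top_iff, ← TensorProduct.span_tmul_eq_top, Submodule.span_le]
    rintro _ ⟨a, b, rfl⟩
    exact tmul_mem_tensorTerm (add_zero 0) (by simp [F.term_zero]) (by simp [F'.term_zero])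
  mul_mem {m n x y} hx hy := by
    have key : ∀ i j, i + j = m → ∀ a ∈ F.term i, ∀ b ∈ F'.term j,
        tensorTerm F F' n ≤ (tensorTerm F F' (m + n)).comap (LinearMap.mulLeft K (a ⊗ₜ[K] b)) := by
      intro i j h a ha b hb
      refine tensorTerm_le fun i' j' h' a' ha' b' hb' => ?_
      simp only [Submodule.mem_comap, LinearMap.mulLeft_apply, Algebra.TensorProduct.tmul_mul_tmul]
      exact tmul_mem_tensorTerm (by omega) (F.mul_mem ha ha') (F'.mul_mem hb hb')
    have : tensorTerm F F' m ≤ (tensorTerm F F' (m + n)).comap (LinearMap.mulRight K y) :=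
      tensorTerm_le fun i j h a ha b hb => key i j h a ha b hb hy
    exact this hx

/-- The map between completions induced by a homomorphism of filtered algebras. -/
def completionMap (F : AlgFiltration K A) (F' : AlgFiltration K B) (f : A →ₐ[K] B)
    (hf : ∀ n, ∀ a ∈ F.term n, f a ∈ F'.term n) : F.completion →ₐ[K] F'.completion :=
  AlgHom.codRestrict
    (AlgHom.pi fun n =>
      (Ideal.Quotient.liftₐ (F.ideal n) ((Ideal.Quotient.mkₐ K (F'.ideal n)).comp f)
        (fun a ha => mk_eq_zero.2 (hf n a ha))).comp (F.proj n))
    F'.compatibleFamilies (by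
      intro x m n h
      obtain ⟨a, ha⟩ := F.mk_surjective n (F.proj n x)
      have hm : F.proj m x = Ideal.Quotient.mkₐ K (F.ideal m) a := by
        rw [← F.transition_proj h, ← ha, F.transition_mk]
      simp only [AlgHom.pi_apply, AlgHom.comp_apply, hm, ← ha]
      rfl)

theorem proj_completionMap {F : AlgFiltration K A} {F' : AlgFiltration K B} {f : A →ₐ[K] B}
    (hf : ∀ n, ∀ a ∈ F.term n, f a ∈ F'.term n) {n : ℕ} {x : F.completion} {a : A}
    (h : F.proj n x = Ideal.Quotient.mkₐ K (F.ideal n) a) :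
    F'.proj n (completionMap F F' f hf x) = Ideal.Quotient.mkₐ K (F'.ideal n) (f a) := by
  change Ideal.Quotient.liftₐ (F.ideal n) ((Ideal.Quotient.mkₐ K (F'.ideal n)).comp f)
    (fun a ha => mk_eq_zero.2 (hf n a ha)) (F.proj n x) = _
  rw [h]
  rfl

theorem completionMap_toCompletion {F : AlgFiltration K A} {F' : AlgFiltration K B} {f : A →ₐ[K] B}
    (hf : ∀ n, ∀ a ∈ F.term n, f a ∈ F'.term n) (a : A) :
    completionMap F F' f hf (F.toCompletion a) = F'.toCompletion (f a) :=
  completion_ext fun n => proj_completionMap hf (F.proj_toCompletion n a)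

theorem eq_of_completionMap_eq {F : AlgFiltration K A} {F' : AlgFiltration K B} {f : A →ₐ[K] B}
    (hf : ∀ n, ∀ a ∈ F.term n, f a ∈ F'.term n) (L : B →ₗ[K] F.completion)
    (hL : ∀ n, ∀ b ∈ F'.term n, L b ∈ F.completionFiltration.term n)
    (hLf : ∀ a, L (f a) = F.toCompletion a) {x : F.completion} {b : B}
    (h : completionMap F F' f hf x = F'.toCompletion b) : L b = x := by
  refine completion_ext fun n => ?_
  obtain ⟨a, ha⟩ := F.mk_surjective n (F.proj n x)
  have h1 := proj_completionMap hf ha.symm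
  rw [h, proj_toCompletion] at h1
  have h2 : b - f a ∈ F'.term n := by
    rw [← mk_eq_zero (F := F'), map_sub, h1, sub_self]
  have h3 := mem_completionTerm.1 (hL n _ h2)
  rw [map_sub, hLf, map_sub, sub_eq_zero, proj_toCompletion, ha] at h3
  exact h3

/-- An element of the completion which is `1` modulo the first term of the filtration is
invertible. -/
theorem isUnit_of_proj_one (F : AlgFiltration K A) {x : F.completion} (hx : F.proj 1 x = 1) :
    IsUnit x := by
  have hn : ∀ n, IsUnit (F.proj n x) := by
    intro n
    rcases n with _ | n
    · have : Subsingleton (A ⧸ F.ideal 0) := Ideal.Quotient.subsingleton_iff.2 (by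
        rw [Ideal.eq_top_iff_one, mem_ideal, F.term_zero]
        trivial)
      exact isUnit_of_subsingleton _
    obtain ⟨a, ha⟩ := F.mk_surjective (n + 1) (F.proj (n + 1) x)
    have h1 : 1 - a ∈ F.term 1 := by
      rw [← mk_eq_zero (F := F), map_sub, map_one, ← F.transition_mk (Nat.le_add_left 1 n), ha,
        F.transition_proj, hx, sub_self]
    have hpow : ∀ k, (1 - a) ^ k ∈ F.term k := by
      intro k
      induction k with
      | zero => simp [F.term_zero]
      | succ k ih => rw [pow_succ]; exact F.mul_mem ih h1
    have hnil : IsNilpotent (1 - F.proj (n + 1) x) :=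
      ⟨n + 1, by rw [← ha, ← map_one (Ideal.Quotient.mkₐ K (F.ideal (n + 1))), ← map_sub, ← map_pow,
        mk_eq_zero]; exact hpow _⟩
    simpa using hnil.isUnit_one_sub
  choose u hu using hn
  have hy : ∃ y : F.completion, ∀ n, F.proj n y = ((u n)⁻¹ : (A ⧸ F.ideal n)ˣ) := by
    refine ⟨⟨fun n => ((u n)⁻¹ : (A ⧸ F.ideal n)ˣ), fun m n h => ?_⟩, fun _ => rfl⟩
    have : Units.map (F.transition h : (A ⧸ F.ideal n) →* (A ⧸ F.ideal m)) (u n) = u m :=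
      Units.ext (by simp [hu, F.transition_proj h x])
    change F.transition h ↑(u n)⁻¹ = ↑(u m)⁻¹
    rw [← this]
    simp
  obtain ⟨y, hy⟩ := hy
  refine ⟨⟨x, y, completion_ext fun n => ?_, completion_ext fun n => ?_⟩, rfl⟩
  · rw [map_mul, map_one, hy, ← hu n, (u n).mul_inv]
  · rw [map_mul, map_one, hy, ← hu n, (u n).inv_mul]

end AlgFiltration

/-! ### Filtered groups and the completed group algebra -/

/-- A filtration (or N-series) `G = F 1 ⊇ F 2 ⊇ F 3 ⊇ ⋯`, `[F i, F j] ⊆ F (i + j)`, of a group. -/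
structure GroupFiltration (G : Type*) [Group G] where
  /-- the `i`-th term of the filtration -/
  term : ℕ+ → Subgroup G
  antitone : Antitone term
  term_one : term 1 = ⊤
  commutator_le : ∀ i j, ⁅term i, term j⁆ ≤ term (i + j)

variable {G : Type*} [Group G]

instance (F : GroupFiltration G) (i : ℕ+) : (F.term i).Normal where
  conj_mem n hn g := by
    have h1 : ⁅g, n⁆ ∈ F.term (1 + i) :=
      F.commutator_le 1 i (Subgroup.commutator_mem_commutator (by simp [F.term_one]) hn)
    have h2 := F.antitone (PNat.lt_add_left i 1).le h1
    simpa [commutatorElement_def] using (F.term i).mul_mem h2 hn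

section GroupAlgebra

variable (K : Type*) [Field K]

/-- The term `F_n K[G]` of the filtration of the group algebra: the subspace spanned by the
products `(g₁ - 1) ⋯ (g_r - 1)` with `g₁ ∈ F k₁, …, g_r ∈ F k_r` and `k₁ + ⋯ + k_r ≥ n`. -/
def groupAlgebraTerm (F : GroupFiltration G) (n : ℕ) : Submodule K (MonoidAlgebra K G) :=
  Submodule.span K {x | ∃ l : List (ℕ+ × G), (∀ p ∈ l, p.2 ∈ F.term p.1) ∧
    n ≤ (l.map fun p => (p.1 : ℕ)).sum ∧
    x = (l.map fun p => MonoidAlgebra.of K G p.2 - 1).prod}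

/-- The filtration of the group algebra of a filtered group. -/
def groupAlgebraFiltration (F : GroupFiltration G) : AlgFiltration K (MonoidAlgebra K G) where
  term := groupAlgebraTerm K F
  antitone m n h := Submodule.span_mono fun _ ⟨l, h1, h2, h3⟩ => ⟨l, h1, h.trans h2, h3⟩
  term_zero := by
    have h1 : (1 : MonoidAlgebra K G) ∈ groupAlgebraTerm K F 0 :=
      Submodule.subset_span ⟨[], by simp, by simp, by simp⟩
    rw [eq_top_iff]
    intro x _
    induction x using MonoidAlgebra.induction_on with
    | of g =>
      have : MonoidAlgebra.of K G g - 1 ∈ groupAlgebraTerm K F 0 :=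
        Submodule.subset_span ⟨[(1, g)], by simp [F.term_one], by simp, by simp⟩
      simpa using Submodule.add_mem _ this h1
    | add f g hf hg => exact Submodule.add_mem _ (hf trivial) (hg trivial)
    | smul r f hf => exact Submodule.smul_mem _ r (hf trivial)
  mul_mem {m n a b} ha hb := by
    have := Submodule.mul_mem_mul ha hb
    rw [groupAlgebraTerm, groupAlgebraTerm, Submodule.span_mul_span] at this
    refine Submodule.span_mono ?_ this
    rintro _ ⟨_, ⟨l, h1, h2, rfl⟩, _, ⟨l', h1', h2', rfl⟩, rfl⟩
    refine ⟨l ++ l', ?_, ?_, by simp⟩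
    · intro p hp
      rcases List.mem_append.1 hp with h | h
      exacts [h1 p h, h1' p h]
    · simpa using add_le_add h2 h2'

/-- The completed group algebra `lim_n K[G] / F_n K[G]`. -/
abbrev CompletedGroupAlgebra (F : GroupFiltration G) : Type _ :=
  (groupAlgebraFiltration K F).completion

/-- The filtration of the completed group algebra. -/
abbrev completedFiltration (F : GroupFiltration G) : AlgFiltration K (CompletedGroupAlgebra K F) :=
  (groupAlgebraFiltration K F).completionFiltration

/-- The complete tensor square of the completed group algebra: the completion of the tensor square
with respect to the tensor product filtration. -/
abbrev CompletedTensorSquare (F : GroupFiltration G) : Type _ :=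
  ((completedFiltration K F).tensor (completedFiltration K F)).completion

/-- The element `x ⊗̂ y` of the complete tensor square. -/
def completedTmul (F : GroupFiltration G) (x y : CompletedGroupAlgebra K F) :
    CompletedTensorSquare K F :=
  ((completedFiltration K F).tensor (completedFiltration K F)).toCompletion (x ⊗ₜ[K] y)

/-- The coproduct of `K[G]` followed by the canonical map to the tensor square of the completed
group algebra. -/
def comulToCompleted (F : GroupFiltration G) :
    MonoidAlgebra K G →ₐ[K] CompletedGroupAlgebra K F ⊗[K] CompletedGroupAlgebra K F :=
  (Algebra.TensorProduct.map (groupAlgebraFiltration K F).toCompletion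
    (groupAlgebraFiltration K F).toCompletion).comp
    (Bialgebra.comulAlgHom K (MonoidAlgebra K G))

theorem comulToCompleted_of (F : GroupFiltration G) (g : G) :
    comulToCompleted K F (MonoidAlgebra.of K G g) =
      (groupAlgebraFiltration K F).toCompletion (MonoidAlgebra.of K G g) ⊗ₜ[K]
      (groupAlgebraFiltration K F).toCompletion (MonoidAlgebra.of K G g) := by
  simp [comulToCompleted]

theorem of_sub_one_mem {F : GroupFiltration G} {i : ℕ+} {g : G} (hg : g ∈ F.term i) :
    MonoidAlgebra.of K G g - 1 ∈ (groupAlgebraFiltration K F).term i :=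
  Submodule.subset_span ⟨[(i, g)], by simpa using hg, by simp, by simp⟩

theorem comulToCompleted_mem (F : GroupFiltration G) (n : ℕ) (a : MonoidAlgebra K G)
    (ha : a ∈ (groupAlgebraFiltration K F).term n) :
    comulToCompleted K F a ∈
      ((completedFiltration K F).tensor (completedFiltration K F)).term n := by
  set T := (completedFiltration K F).tensor (completedFiltration K F) with hT
  have hgen : ∀ (i : ℕ+) (g : G), g ∈ F.term i →
      comulToCompleted K F (MonoidAlgebra.of K G g - 1) ∈ T.term i := by
    intro i g hg
    have h := AlgFiltration.toCompletion_mem (of_sub_one_mem K hg)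
    rw [map_sub, map_one] at h
    rw [map_sub, map_one, comulToCompleted_of, Algebra.TensorProduct.one_def]
    set y := (groupAlgebraFiltration K F).toCompletion (MonoidAlgebra.of K G g) with hy
    have e : y ⊗ₜ[K] y - 1 ⊗ₜ[K] 1 = (y - 1) ⊗ₜ[K] y + 1 ⊗ₜ[K] (y - 1) := by
      rw [TensorProduct.sub_tmul, TensorProduct.tmul_sub]; abel
    rw [e]
    refine (T.term i).add_mem ?_ ?_
    · exact AlgFiltration.tmul_mem_tensorTerm (add_zero _) h
        (by rw [(completedFiltration K F).term_zero]; trivial)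
    · exact AlgFiltration.tmul_mem_tensorTerm (zero_add _)
        (by rw [(completedFiltration K F).term_zero]; trivial) h
  suffices h : (groupAlgebraFiltration K F).term n ≤
      (T.term n).comap (comulToCompleted K F).toLinearMap from h ha
  refine Submodule.span_le.2 ?_
  rintro _ ⟨l, hl, hn, rfl⟩
  change comulToCompleted K F _ ∈ T.term n
  refine T.antitone hn ?_
  clear hn
  induction l with
  | nil => rw [List.map_nil, List.sum_nil, T.term_zero]; trivial
  | cons p l ih =>
    rw [List.map_cons, List.map_cons, List.prod_cons, List.sum_cons, map_mul]
    exact T.mul_mem (hgen _ _ (hl p List.mem_cons_self))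
      (ih fun q hq => hl q (List.mem_cons_of_mem _ hq))

/-- The coproduct `Δ̂` of the completed group algebra, induced by the coproduct of `K[G]`. -/
def completedComul (F : GroupFiltration G) :
    CompletedGroupAlgebra K F →ₐ[K] CompletedTensorSquare K F :=
  AlgFiltration.completionMap (groupAlgebraFiltration K F) _ (comulToCompleted K F)
    (comulToCompleted_mem K F)

/-- Group-like elements of the completed group algebra. -/
def IsGroupLike (F : GroupFiltration G) (x : CompletedGroupAlgebra K F) : Prop :=
  completedComul K F x = completedTmul K F x x ∧ x ≠ 0

theorem counit_eq_zero (F : GroupFiltration G) (a : MonoidAlgebra K G)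
    (ha : a ∈ (groupAlgebraFiltration K F).term 1) :
    Bialgebra.counitAlgHom K (MonoidAlgebra K G) a = 0 := by
  suffices h : (groupAlgebraFiltration K F).term 1 ≤
      LinearMap.ker (Bialgebra.counitAlgHom K (MonoidAlgebra K G)).toLinearMap from h ha
  refine Submodule.span_le.2 ?_
  rintro _ ⟨l, hl, hn, rfl⟩
  rcases l with _ | ⟨p, l⟩
  · simp at hn
  · simp [LinearMap.mem_ker]

/-- The counit of the completed group algebra. -/
def completedCounit (F : GroupFiltration G) : CompletedGroupAlgebra K F →ₐ[K] K :=
  (Ideal.Quotient.liftₐ ((groupAlgebraFiltration K F).ideal 1)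
    (Bialgebra.counitAlgHom K (MonoidAlgebra K G)) (counit_eq_zero K F)).comp
    ((groupAlgebraFiltration K F).proj 1)

theorem completedCounit_toCompletion (F : GroupFiltration G) (a : MonoidAlgebra K G) :
    completedCounit K F ((groupAlgebraFiltration K F).toCompletion a) =
      Bialgebra.counitAlgHom K (MonoidAlgebra K G) a :=
  rfl

instance (F : GroupFiltration G) : Nontrivial (CompletedGroupAlgebra K F) :=
  (completedCounit K F).toRingHom.domain_nontrivial

/-- The contraction `ε̂ ⊗ id` of the tensor square of the completed group algebra. -/
def counitContract (F : GroupFiltration G) :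
    CompletedGroupAlgebra K F ⊗[K] CompletedGroupAlgebra K F →ₐ[K] CompletedGroupAlgebra K F :=
  (Algebra.TensorProduct.lid K (CompletedGroupAlgebra K F)).toAlgHom.comp
    (Algebra.TensorProduct.map (completedCounit K F) (AlgHom.id K _))

theorem counitContract_tmul (F : GroupFiltration G) (x y : CompletedGroupAlgebra K F) :
    counitContract K F (x ⊗ₜ[K] y) = completedCounit K F x • y := by
  simp [counitContract]

theorem counitContract_comul (F : GroupFiltration G) (a : MonoidAlgebra K G) :
    counitContract K F (comulToCompleted K F a) =
      (groupAlgebraFiltration K F).toCompletion a := by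
  induction a using MonoidAlgebra.induction_on with
  | of g =>
    rw [comulToCompleted_of, counitContract_tmul, completedCounit_toCompletion]
    simp
  | add f g hf hg => rw [map_add, map_add, hf, hg, map_add]
  | smul r f hf => rw [map_smul, map_smul, hf, map_smul]

theorem counitContract_mem (F : GroupFiltration G) (n : ℕ)
    (z : CompletedGroupAlgebra K F ⊗[K] CompletedGroupAlgebra K F)
    (hz : z ∈ ((completedFiltration K F).tensor (completedFiltration K F)).term n) :
    counitContract K F z ∈ (completedFiltration K F).term n := by
  have h : AlgFiltration.tensorTerm (completedFiltration K F) (completedFiltration K F) n ≤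
      ((completedFiltration K F).term n).comap (counitContract K F).toLinearMap := by
    refine AlgFiltration.tensorTerm_le fun i j h a ha b hb => ?_
    change counitContract K F (a ⊗ₜ[K] b) ∈ (completedFiltration K F).term n
    rw [counitContract_tmul]
    rcases i with _ | i
    · obtain rfl : j = n := by omega
      exact ((completedFiltration K F).term j).smul_mem _ hb
    · have h0 : (groupAlgebraFiltration K F).proj 1 a = 0 :=
        AlgFiltration.mem_completionTerm.1
          ((completedFiltration K F).antitone (Nat.le_add_left 1 i) ha)
      have h1 : completedCounit K F a = 0 := by
        simp only [completedCounit, AlgHom.comp_apply, h0, map_zero]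
      rw [h1, zero_smul]
      exact ((completedFiltration K F).term n).zero_mem
  exact h hz

theorem sub_counit_mem (F : GroupFiltration G) (b : MonoidAlgebra K G) :
    b - Bialgebra.counitAlgHom K (MonoidAlgebra K G) b • (1 : MonoidAlgebra K G) ∈
      (groupAlgebraFiltration K F).term 1 := by
  induction b using MonoidAlgebra.induction_on with
  | of g =>
    have := of_sub_one_mem K (F := F) (i := 1) (g := g) (by simp [F.term_one])
    simpa using this
  | add f g hf hg =>
    rw [map_add, add_smul, add_sub_add_comm]
    exact Submodule.add_mem _ hf hg
  | smul r f hf =>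
    have := Submodule.smul_mem _ r hf
    rwa [smul_sub, smul_smul, ← smul_eq_mul, ← map_smul] at this

theorem proj_one_eq (F : GroupFiltration G) (x : CompletedGroupAlgebra K F) :
    (groupAlgebraFiltration K F).proj 1 x = completedCounit K F x • 1 := by
  obtain ⟨a, ha⟩ := (groupAlgebraFiltration K F).mk_surjective 1
    ((groupAlgebraFiltration K F).proj 1 x)
  have hε : Bialgebra.counitAlgHom K (MonoidAlgebra K G) a = completedCounit K F x := by
    rw [completedCounit, AlgHom.comp_apply, ← ha]
    rfl
  have h := sub_counit_mem K F a
  rw [hε, ← AlgFiltration.mk_eq_zero (F := groupAlgebraFiltration K F), map_sub, ha,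
    map_smul, map_one, sub_eq_zero] at h
  exact h

theorem IsGroupLike.counit_eq_one {F : GroupFiltration G} {x : CompletedGroupAlgebra K F}
    (hx : IsGroupLike K F x) : completedCounit K F x = 1 := by
  have hfix : completedCounit K F x • x = x := by
    rw [← counitContract_tmul]
    exact AlgFiltration.eq_of_completionMap_eq (comulToCompleted_mem K F)
      (counitContract K F).toLinearMap (counitContract_mem K F) (counitContract_comul K F) hx.1
  have h : (completedCounit K F x - 1) • x = 0 := by rw [sub_smul, one_smul, hfix, sub_self]
  by_contra hne
  apply hx.2
  have hne' : completedCounit K F x - 1 ≠ 0 := sub_ne_zero.2 hne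
  rw [← one_smul K x, ← inv_mul_cancel₀ hne', ← smul_smul, h, smul_zero]

theorem IsGroupLike.proj_one {F : GroupFiltration G} {x : CompletedGroupAlgebra K F}
    (hx : IsGroupLike K F x) : (groupAlgebraFiltration K F).proj 1 x = 1 := by
  rw [proj_one_eq, hx.counit_eq_one, one_smul]

theorem completedTmul_mul (F : GroupFiltration G) (x y x' y' : CompletedGroupAlgebra K F) :
    completedTmul K F x y * completedTmul K F x' y' = completedTmul K F (x * x') (y * y') := by
  exact (map_mul ((completedFiltration K F).tensor (completedFiltration K F)).toCompletion _ _).symm.trans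
    (congrArg _ (Algebra.TensorProduct.tmul_mul_tmul x x' y y'))

theorem completedTmul_one (F : GroupFiltration G) : completedTmul K F 1 1 = 1 := by
  rw [completedTmul, ← Algebra.TensorProduct.one_def, map_one]

theorem IsGroupLike.isUnit {F : GroupFiltration G} {x : CompletedGroupAlgebra K F}
    (hx : IsGroupLike K F x) : IsUnit x :=
  AlgFiltration.isUnit_of_proj_one _ (hx.proj_one K)

/-- The Malcev completion of a filtered group: the group-like elements of the completed group
algebra, with the multiplication of the completed group algebra. -/
def MalcevCompletion (F : GroupFiltration G) : Submonoid (CompletedGroupAlgebra K F) where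
  carrier := {x | IsGroupLike K F x}
  mul_mem' {x y} hx hy := by
    refine ⟨by rw [map_mul, hx.1, hy.1, completedTmul_mul], ?_⟩
    exact ((hx.isUnit K).mul (hy.isUnit K)).ne_zero
  one_mem' := ⟨by rw [map_one, completedTmul_one], one_ne_zero⟩

theorem exists_mul_eq_one (F : GroupFiltration G) (x : MalcevCompletion K F) :
    ∃ y : MalcevCompletion K F, y * x = 1 := by
  obtain ⟨x, hx⟩ := x
  obtain ⟨u, hu⟩ := IsGroupLike.isUnit K hx
  have hx' : IsGroupLike K F x := hx
  have e1 : completedTmul K F x x * completedTmul K F ↑u⁻¹ ↑u⁻¹ = 1 := by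
    rw [completedTmul_mul, ← hu, u.mul_inv, completedTmul_one]
  have e2 : completedComul K F ↑u⁻¹ * completedTmul K F x x = 1 := by
    rw [← hx'.1, ← map_mul, ← hu, u.inv_mul, map_one]
  refine ⟨⟨↑u⁻¹, left_inv_eq_right_inv e2 e1, u⁻¹.isUnit.ne_zero⟩, Subtype.ext ?_⟩
  change (↑u⁻¹ : CompletedGroupAlgebra K F) * x = 1
  rw [← hu, u.inv_mul]

instance (F : GroupFiltration G) : Group (MalcevCompletion K F) :=
  { (inferInstance : Monoid (MalcevCompletion K F)) with
    inv := fun x => (exists_mul_eq_one K F x).choose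
    inv_mul_cancel := fun x => (exists_mul_eq_one K F x).choose_spec }

/-- The filtration `F_i M = M ∩ (1 + F_i)` of the Malcev completion `M`. -/
def malcevTerm (F : GroupFiltration G) (i : ℕ+) : Subgroup (MalcevCompletion K F) where
  carrier := {x | (x : CompletedGroupAlgebra K F) - 1 ∈ (completedFiltration K F).term i}
  mul_mem' {x y} hx hy := by
    have h := Submodule.add_mem _
      (((completedFiltration K F).ideal i).mul_mem_left (x : CompletedGroupAlgebra K F) hy) hx
    have e : ((x * y : MalcevCompletion K F) : CompletedGroupAlgebra K F) - 1 =
        (x : CompletedGroupAlgebra K F) * ((y : CompletedGroupAlgebra K F) - 1) +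
          ((x : CompletedGroupAlgebra K F) - 1) := by
      rw [Submonoid.coe_mul, mul_sub, mul_one]; abel
    rw [Set.mem_ofPred_eq, e]
    exact h
  one_mem' := by simp
  inv_mem' {x} hx := by
    have h := Submodule.neg_mem _ (((completedFiltration K F).ideal i).mul_mem_left
      ((x⁻¹ : MalcevCompletion K F) : CompletedGroupAlgebra K F) hx)
    have e : ((x⁻¹ : MalcevCompletion K F) : CompletedGroupAlgebra K F) - 1 =
        -(((x⁻¹ : MalcevCompletion K F) : CompletedGroupAlgebra K F) *
          ((x : CompletedGroupAlgebra K F) - 1)) := by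
      rw [mul_sub, mul_one, ← Submonoid.coe_mul, inv_mul_cancel, Submonoid.coe_one]; abel
    rw [Set.mem_ofPred_eq, e]
    exact h

instance (F : GroupFiltration G) (i : ℕ+) : (malcevTerm K F i).Normal where
  conj_mem x hx g := by
    have h := ((completedFiltration K F).ideal i).mul_mem_right
      ((g⁻¹ : MalcevCompletion K F) : CompletedGroupAlgebra K F)
      (((completedFiltration K F).ideal i).mul_mem_left (g : CompletedGroupAlgebra K F) hx)
    have e : ((g * x * g⁻¹ : MalcevCompletion K F) : CompletedGroupAlgebra K F) - 1 =
        (g : CompletedGroupAlgebra K F) * ((x : CompletedGroupAlgebra K F) - 1) *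
          ((g⁻¹ : MalcevCompletion K F) : CompletedGroupAlgebra K F) := by
      rw [mul_sub, sub_mul, mul_one, ← Submonoid.coe_mul, ← Submonoid.coe_mul, ← Submonoid.coe_mul,
        mul_inv_cancel, Submonoid.coe_one]
    change ((g * x * g⁻¹ : MalcevCompletion K F) : CompletedGroupAlgebra K F) - 1 ∈
      (completedFiltration K F).term i
    rw [e]
    exact h

/-- The canonical map `ι : G → M` from a filtered group to its Malcev completion. -/
def iota (F : GroupFiltration G) : G →* MalcevCompletion K F :=
  ((groupAlgebraFiltration K F).toCompletion.toMonoidHom.comp (MonoidAlgebra.of K G)).codRestrict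
    (MalcevCompletion K F) fun g => by
      refine ⟨?_, ?_⟩
      · exact (AlgFiltration.completionMap_toCompletion (comulToCompleted_mem K F) _).trans
          (congrArg _ (comulToCompleted_of K F g))
      · exact (((Group.isUnit g).map (MonoidAlgebra.of K G)).map
          (groupAlgebraFiltration K F).toCompletion).ne_zero

end GroupAlgebra

/-! ### Uniquely divisible closures and inverse limits of groups -/

/-- A homomorphism `j : N → D` of groups exhibits `D` as a uniquely divisible closure of the
nilpotent group `N`. -/
structure IsUniquelyDivisibleClosure {N D : Type*} [Group N] [Group D] (j : N →* D) : Prop where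
  /-- `D` is nilpotent -/
  nilpotent : Group.IsNilpotent D
  /-- `D` is uniquely divisible -/
  existsUnique_root : ∀ (y : D) (k : ℕ), 1 ≤ k → ∃! x : D, x ^ k = y
  /-- the kernel of `j` is the set of torsion elements of `N` -/
  mem_ker_iff : ∀ n : N, n ∈ j.ker ↔ IsOfFinOrder n
  /-- every element of `D` has a positive power in the image of `j` -/
  exists_pow_mem_range : ∀ x : D, ∃ k : ℕ, 1 ≤ k ∧ x ^ k ∈ j.range

/-- The inverse limit of a system of groups `D i` with the given maps `t : D k → D i`, `i ≤ k`. -/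
def inverseLimit {D : ℕ+ → Type*} [∀ i, Group (D i)] (t : ∀ i k : ℕ+, i ≤ k → (D k →* D i)) :
    Subgroup (∀ i, D i) where
  carrier := {x | ∀ (i k : ℕ+) (h : i ≤ k), t i k h (x k) = x i}
  mul_mem' hx hy i k h := by simp [hx i k h, hy i k h]
  one_mem' i k h := by simp
  inv_mem' hx i k h := by simp [hx i k h]

end Malcev

end

noncomputable section

namespace Malcev
namespace AlgFiltration

/-! ### Unique roots of elements congruent to 1. -/

section Roots

variable {K A : Type*} [Field K] [Ring A] [Algebra K A] (F : AlgFiltration K A)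

/-! Write M for the Malcev completion. It is complete and separated for its filtration
(`exists_forall_mk_eq`, `eq_of_forall_mk_eq`), so it is the inverse limit of the quotients M/F_iM.
Hence everything follows once G/F_iG → M/F_iM is known to be a uniquely divisible closure
(`isUniquelyDivisibleClosure_iotaQuotient`), because such closures are unique up to unique
isomorphism and functorial. For the functoriality, the extension of a homomorphism N → E to the
closure D is obtained from its graph: the elements of D × E having a power in the image of N form a
subgroup, by nilpotency (`isolator`, `exists_lift`), and this subgroup is the graph of a map.

Being a closure comes down to three facts.

Roots. In a filtered algebra in characteristic zero, raising to the k-th power acts on 1 + F_n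
modulo F_{n+1} as multiplication by k. So elements congruent to 1 have unique k-th roots in the
completion. Uniqueness in the completed tensor square shows that a root of a group-like element is
group-like (`exists_pow_eq`).

Kernel. An element g dies in M/F_iM if and only if g - 1 ∈ F_i ℚ[G], and then some power of g lies
in F_iG (`exists_pow_mem_term`, the theorem of Jennings and Lazard in characteristic zero). The
proof descends along F. When F_w is the whole group, homomorphisms to ℚ detect F_{w+1} up to
torsion; the group is then replaced by F_{w+1}. The descent needs that membership of g - 1 in F_n
passes to the group algebra of the subgroup. By finite generation it suffices to remove one
generator t at a time, and for a cyclic extension a crossed homomorphism, built from a root of a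
power of t, makes the larger group act on the completed group algebra of the smaller one
(`mem_term_of_cyclic_extension`).

Image. For z in F_iM the class of z - 1 in degree i is primitive. The Dynkin operator S * Y, where S
is the antipode and Y multiplies by the degree, multiplies primitive elements of degree i by i and
maps products of elements g - 1 to iterated commutators. Hence primitives are rational combinations
of elements g - 1 (`mem_liePart_of_primitive`), with no need for the Poincaré-Birkhoff-Witt theorem.
Clearing denominators, a power of z agrees with some ι(h) modulo F_{i+1}M, and induction on i gives
a power of any element of M in the image of G modulo F_iM (`exists_pow_eq_iota`). -/

theorem mem_term_zero (a : A) : a ∈ F.term 0 := by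
  rw [F.term_zero]; trivial

theorem mul_mem_left {n : ℕ} (a : A) {b : A} (hb : b ∈ F.term n) : a * b ∈ F.term n := by
  simpa using F.mul_mem (F.mem_term_zero a) hb

theorem mul_mem_right {n : ℕ} {a : A} (b : A) (ha : a ∈ F.term n) : a * b ∈ F.term n := by
  simpa using F.mul_mem ha (F.mem_term_zero b)

theorem pow_sub_one_mem {n : ℕ} {a : A} (ha : a - 1 ∈ F.term n) (k : ℕ) :
    a ^ k - 1 ∈ F.term n := by
  induction k with
  | zero => simp
  | succ k ih =>
    have e : a ^ (k + 1) - 1 = a ^ k * (a - 1) + (a ^ k - 1) := by rw [pow_succ]; noncomm_ring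
    rw [e]
    exact add_mem (F.mul_mem_left _ ha) ih

/-- Multiplication by a or b is the identity on F_j/F_{j+1}, so each of the k summands of the
telescoped difference contributes a - b. This linearisation underlies both existence and uniqueness
of roots. -/
theorem pow_sub_pow_sub_mem {j : ℕ} {a b : A} (ha : a - 1 ∈ F.term 1) (hb : b - 1 ∈ F.term 1)
    (hab : a - b ∈ F.term j) (k : ℕ) :
    a ^ k - b ^ k - (k : K) • (a - b) ∈ F.term (j + 1) := by
  induction k with
  | zero => simp
  | succ k ih =>
    have h1 : (a ^ k - 1) * (a - b) ∈ F.term (j + 1) := by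
      rw [add_comm]; exact F.mul_mem (F.pow_sub_one_mem ha k) hab
    have h2 : (a - b) * (b - 1) ∈ F.term (j + 1) := F.mul_mem hab hb
    have e : a ^ (k + 1) - b ^ (k + 1) - ((k + 1 : ℕ) : K) • (a - b) =
        (a ^ k - 1) * (a - b) + (a ^ k - b ^ k - (k : K) • (a - b)) * b +
          (k : K) • ((a - b) * (b - 1)) := by
      simp only [pow_succ, Nat.cast_succ, add_smul, one_smul, sub_mul, mul_sub, smul_sub,
        smul_mul_assoc, mul_one, one_mul]
      abel
    rw [e]
    exact add_mem (add_mem h1 (F.mul_mem_right b ih)) (Submodule.smul_mem _ _ h2)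

theorem eq_of_forall_sub_mem {x y : F.completion}
    (h : ∀ n, x - y ∈ F.completionFiltration.term n) : x = y := by
  refine completion_ext fun n => ?_
  rw [← sub_eq_zero, ← map_sub]
  exact mem_completionTerm.1 (h n)

/-- Cauchy sequences converge in the completion. -/
theorem exists_limit (y : ℕ → F.completion)
    (hy : ∀ n, y (n + 1) - y n ∈ F.completionFiltration.term n) :
    ∃ x : F.completion, ∀ n, x - y n ∈ F.completionFiltration.term n := by
  have key : ∀ m n, m ≤ n → F.proj m (y n) = F.proj m (y m) := by
    intro m n h
    induction n, h using Nat.le_induction with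
    | base => rfl
    | succ n h ih =>
      rw [← ih, ← sub_eq_zero, ← map_sub]
      exact mem_completionTerm.1 (F.completionFiltration.antitone h (hy n))
  obtain ⟨x, hx⟩ : ∃ x : F.completion, ∀ n, F.proj n x = F.proj n (y n) :=
    ⟨⟨fun n => F.proj n (y n), fun m n h => by rw [F.transition_proj h, key m n h]⟩, fun _ => rfl⟩
  exact ⟨x, fun n => mem_completionTerm.2 (by rw [map_sub, hx, sub_self])⟩

variable [CharZero K]

/-- Roots of elements congruent to `1` are unique modulo each term of the filtration. -/
theorem sub_mem_of_pow_sub_pow_mem {n k : ℕ} (hk : 1 ≤ k) {a b : A} (ha : a - 1 ∈ F.term 1)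
    (hb : b - 1 ∈ F.term 1) (h : a ^ k - b ^ k ∈ F.term n) : a - b ∈ F.term n := by
  have hk' : (k : K) ≠ 0 := Nat.cast_ne_zero.2 (by omega)
  -- Climb the filtration one step at a time: if a - b is in F_j with j < n, then k(a - b) is in
  -- F_{j+1}, and k is invertible.
  suffices ∀ j ≤ n, a - b ∈ F.term j from this n le_rfl
  intro j
  induction j with
  | zero => intro _; exact F.mem_term_zero _
  | succ j ih =>
    intro hj
    have h1 := F.pow_sub_pow_sub_mem ha hb (ih (by omega)) k
    have h2 := sub_mem (F.antitone hj h) h1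
    rw [sub_sub_cancel] at h2
    exact (Submodule.smul_mem_iff _ hk').1 h2

theorem sub_one_mem_of_pow {n k : ℕ} (hk : 1 ≤ k) {a : A} (ha : a - 1 ∈ F.term 1)
    (h : a ^ k - 1 ∈ F.term n) : a - 1 ∈ F.term n :=
  F.sub_mem_of_pow_sub_pow_mem hk ha (by simp) (by rwa [one_pow])

theorem eq_of_pow_eq_pow {k : ℕ} (hk : 1 ≤ k) {x y : F.completion}
    (hx : x - 1 ∈ F.completionFiltration.term 1) (hy : y - 1 ∈ F.completionFiltration.term 1)
    (h : x ^ k = y ^ k) : x = y :=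
  F.eq_of_forall_sub_mem fun n => F.completionFiltration.sub_mem_of_pow_sub_pow_mem hk hx hy
    (by rw [h, sub_self]; exact zero_mem _)

/-- Elements of the completion congruent to `1` have roots. -/
theorem exists_root {k : ℕ} (hk : 1 ≤ k) {x : F.completion}
    (hx : x - 1 ∈ F.completionFiltration.term 1) :
    ∃ y : F.completion, y - 1 ∈ F.completionFiltration.term 1 ∧ y ^ k = x := by
  set C := F.completionFiltration with hC
  have hk' : (k : K) ≠ 0 := Nat.cast_ne_zero.2 (by omega)
  -- Newton iteration for y^k = x, with the derivative replaced by its value k at 1. Each step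
  -- improves the error by one filtration degree.
  let next : F.completion → F.completion := fun y => y + (k : K)⁻¹ • (x - y ^ k)
  let y : ℕ → F.completion := fun n => next^[n] 1
  have hsucc : ∀ n, y (n + 1) = y n + (k : K)⁻¹ • (x - y n ^ k) := fun n =>
    Function.iterate_succ_apply' next n 1
  have hdiff : ∀ n, y (n + 1) - y n = (k : K)⁻¹ • (x - y n ^ k) := fun n => by
    rw [hsucc, add_sub_cancel_left]
  have hy : ∀ n, y n - 1 ∈ C.term 1 ∧ x - y n ^ k ∈ C.term (n + 1) := by
    intro n
    induction n with
    | zero => simpa [y] using hx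
    | succ n ih =>
      have hd : y (n + 1) - y n ∈ C.term (n + 1) := by
        rw [hdiff]; exact Submodule.smul_mem _ _ ih.2
      have h1 : y (n + 1) - 1 ∈ C.term 1 := by
        have := add_mem (C.antitone (by omega : 1 ≤ n + 1) hd) ih.1
        rwa [sub_add_sub_cancel] at this
      refine ⟨h1, ?_⟩
      have h2 := C.pow_sub_pow_sub_mem h1 ih.1 hd k
      rw [hdiff, smul_smul, mul_inv_cancel₀ hk', one_smul] at h2
      have := neg_mem h2
      convert this using 1
      abel
  obtain ⟨z, hz⟩ := F.exists_limit y fun n => by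
    rw [hdiff]; exact Submodule.smul_mem _ _ (C.antitone (by omega) (hy n).2)
  have hz1 : z - 1 ∈ C.term 1 := by
    have := add_mem (hz 1) (hy 1).1
    rwa [sub_add_sub_cancel] at this
  refine ⟨z, hz1, F.eq_of_forall_sub_mem fun n => ?_⟩
  have h1 := C.pow_sub_pow_sub_mem hz1 (hy n).1 (hz n) k
  have h2 := add_mem (C.antitone (by omega : n ≤ n + 1) h1) (Submodule.smul_mem _ (k : K) (hz n))
  rw [sub_add_cancel] at h2
  have := sub_mem h2 (C.antitone (by omega : n ≤ n + 1) (hy n).2)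
  convert this using 1
  abel

end Roots

end AlgFiltration
namespace AlgFiltration

/-! ### Units congruent to 1, and density in the completion. -/

section Completion

variable {K A B : Type*} [CommRing K] [Ring A] [Algebra K A] [Ring B] [Algebra K B]
  {F : AlgFiltration K A} {F' : AlgFiltration K B}

/-- The group of units congruent to `1` modulo the `n`-th term of a filtration. -/
def oneUnits (F : AlgFiltration K A) (n : ℕ) : Subgroup Aˣ where
  carrier := {x | (x : A) - 1 ∈ F.term n}
  mul_mem' {x y} hx hy := by
    have e : ((x * y : Aˣ) : A) - 1 = x * ((y : A) - 1) + ((x : A) - 1) := by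
      rw [Units.val_mul]; noncomm_ring
    rw [Set.mem_ofPred_eq, e]
    exact add_mem ((F.ideal n).mul_mem_left _ hy) hx
  one_mem' := by simp
  inv_mem' {x} hx := by
    have e : ((x⁻¹ : Aˣ) : A) - 1 = -(((x⁻¹ : Aˣ) : A) * ((x : A) - 1)) := by
      rw [mul_sub, Units.inv_mul, mul_one]; abel
    rw [Set.mem_ofPred_eq, e]
    exact neg_mem ((F.ideal n).mul_mem_left _ hx)

theorem mem_oneUnits {n : ℕ} {x : Aˣ} : x ∈ F.oneUnits n ↔ (x : A) - 1 ∈ F.term n :=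
  Iff.rfl

theorem toCompletion_mem_iff {n : ℕ} {a : A} :
    F.toCompletion a ∈ F.completionFiltration.term n ↔ a ∈ F.term n :=
  mem_completionTerm.trans (by rw [proj_toCompletion, mk_eq_zero])

/-- The image of a filtered algebra is dense in its completion. -/
theorem exists_sub_toCompletion_mem (x : F.completion) (n : ℕ) :
    ∃ a : A, x - F.toCompletion a ∈ F.completionFiltration.term n := by
  obtain ⟨a, ha⟩ := F.mk_surjective n (F.proj n x)
  exact ⟨a, mem_completionTerm.2 (by rw [map_sub, proj_toCompletion, ha, sub_self])⟩

theorem completionMap_mem {f : A →ₐ[K] B} (hf : ∀ n, ∀ a ∈ F.term n, f a ∈ F'.term n) {n : ℕ}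
    {x : F.completion} (hx : x ∈ F.completionFiltration.term n) :
    completionMap F F' f hf x ∈ F'.completionFiltration.term n := by
  refine mem_completionTerm.2 ?_
  rw [proj_completionMap hf (a := 0), map_zero, map_zero]
  rw [map_zero]
  exact mem_completionTerm.1 hx

/-- If a linear endomorphism of the completion preserves the filtration and shifts the filtration of
the dense subalgebra by `i`, it shifts the filtration of the completion by `i`. -/
theorem map_mem_of_dense {i j : ℕ} {f : F.completion →ₗ[K] F.completion}
    (hf : ∀ n, ∀ x ∈ F.completionFiltration.term n, f x ∈ F.completionFiltration.term n)
    (h : ∀ a ∈ F.term j, f (F.toCompletion a) ∈ F.completionFiltration.term (i + j))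
    {x : F.completion} (hx : x ∈ F.completionFiltration.term j) :
    f x ∈ F.completionFiltration.term (i + j) := by
  obtain ⟨a, ha⟩ := exists_sub_toCompletion_mem x (i + j)
  have haj : a ∈ F.term j := by
    rw [← toCompletion_mem_iff]
    have := sub_mem hx (F.completionFiltration.antitone (Nat.le_add_left j i) ha)
    rwa [sub_sub_cancel] at this
  have := add_mem (hf _ _ ha) (h a haj)
  rwa [map_sub, sub_add_cancel] at this

/-- Filtration-preserving maps are continuous, and A is dense in its completion. -/
theorem hom_ext_of_dense {f g : F.completion →ₗ[K] F.completion}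
    (hf : ∀ n, ∀ x ∈ F.completionFiltration.term n, f x ∈ F.completionFiltration.term n)
    (hg : ∀ n, ∀ x ∈ F.completionFiltration.term n, g x ∈ F.completionFiltration.term n)
    (h : ∀ a, f (F.toCompletion a) = g (F.toCompletion a)) : f = g := by
  ext x
  refine completion_ext fun n => ?_
  obtain ⟨a, ha⟩ := exists_sub_toCompletion_mem x n
  have h1 := sub_mem (hf _ _ ha) (hg _ _ ha)
  rw [map_sub, map_sub, h, sub_sub_sub_cancel_right] at h1
  rw [← sub_eq_zero, ← map_sub]
  exact mem_completionTerm.1 h1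

end Completion

end AlgFiltration

/-- The filtration of a group `H` induced by a homomorphism to a filtered group. -/
def GroupFiltration.comap {G H : Type*} [Group G] [Group H] (F : GroupFiltration G) (f : H →* G) :
    GroupFiltration H where
  term i := (F.term i).comap f
  antitone _ _ h := Subgroup.comap_mono (F.antitone h)
  term_one := by rw [F.term_one, Subgroup.comap_top]
  commutator_le i j := Subgroup.commutator_le.2 fun a ha b hb => by
    rw [Subgroup.mem_comap, map_commutatorElement]
    exact F.commutator_le i j (Subgroup.commutator_mem_commutator ha hb)

theorem GroupFiltration.mem_comap {G H : Type*} [Group G] [Group H] {F : GroupFiltration G}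
    {f : H →* G} {i : ℕ+} {h : H} : h ∈ (F.comap f).term i ↔ f h ∈ F.term i :=
  Iff.rfl

/-! ### Actions and functoriality of filtered group algebras; conjugation on a normal subgroup. -/

section GroupAlgebra

variable {K : Type*} [Field K] {G H : Type*} [Group G] [Group H]

/-- A representation in which each `g - 1`, `g ∈ F i`, shifts a descending chain of subspaces by
`i` is a representation by which `F_n K[G]` shifts this chain by `n`. -/
theorem lift_mem_of_mem_term (F : GroupFiltration G) {V : Type*} [AddCommGroup V] [Module K V]
    (C : ℕ → Submodule K V) (hC : Antitone C) (ρ : G →* Module.End K V)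
    (hρ : ∀ (i : ℕ+) (g : G), g ∈ F.term i → ∀ (j : ℕ), ∀ v ∈ C j, ρ g v - v ∈ C (i + j))
    {n j : ℕ} {a : MonoidAlgebra K G} (ha : a ∈ (groupAlgebraFiltration K F).term n) {v : V}
    (hv : v ∈ C j) : MonoidAlgebra.lift K (Module.End K V) G ρ a v ∈ C (n + j) := by
  suffices h : (groupAlgebraFiltration K F).term n ≤
      (C (n + j)).comap ((LinearMap.applyₗ v).comp
        (MonoidAlgebra.lift K (Module.End K V) G ρ).toLinearMap) from h ha
  refine Submodule.span_le.2 ?_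
  rintro _ ⟨l, hl, hn, rfl⟩
  change MonoidAlgebra.lift K (Module.End K V) G ρ _ v ∈ C (n + j)
  refine hC (Nat.add_le_add_right hn j) ?_
  clear hn ha
  induction l with
  | nil => simpa using hv
  | cons p l ih =>
    rw [List.map_cons, List.map_cons, List.prod_cons, List.sum_cons, map_mul, Module.End.mul_apply,
      map_sub, map_one, MonoidAlgebra.lift_of, LinearMap.sub_apply, Module.End.one_apply, add_assoc]
    exact hρ _ _ (hl p List.mem_cons_self) _ _ (ih fun q hq => hl q (List.mem_cons_of_mem _ hq))

variable (K) in
/-- The homomorphism of group algebras induced by a homomorphism of groups. -/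
def groupAlgebraMap (f : G →* H) : MonoidAlgebra K G →ₐ[K] MonoidAlgebra K H :=
  MonoidAlgebra.lift K _ G ((MonoidAlgebra.of K H).comp f)

theorem groupAlgebraMap_of (f : G →* H) (g : G) :
    groupAlgebraMap K f (MonoidAlgebra.of K G g) = MonoidAlgebra.of K H (f g) :=
  MonoidAlgebra.lift_of _ _

theorem groupAlgebraMap_mem {F : GroupFiltration G} {F' : GroupFiltration H} {f : G →* H}
    (hf : ∀ i, ∀ g ∈ F.term i, f g ∈ F'.term i) (n : ℕ) (a : MonoidAlgebra K G)
    (ha : a ∈ (groupAlgebraFiltration K F).term n) :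
    groupAlgebraMap K f a ∈ (groupAlgebraFiltration K F').term n := by
  suffices h : (groupAlgebraFiltration K F).term n ≤
      ((groupAlgebraFiltration K F').term n).comap (groupAlgebraMap K f).toLinearMap from h ha
  refine Submodule.span_le.2 ?_
  rintro _ ⟨l, hl, hn, rfl⟩
  change groupAlgebraMap K f _ ∈ (groupAlgebraFiltration K F').term n
  refine (groupAlgebraFiltration K F').antitone hn ?_
  clear hn ha
  induction l with
  | nil => exact (groupAlgebraFiltration K F').mem_term_zero _
  | cons p l ih =>
    rw [List.map_cons, List.map_cons, List.prod_cons, List.sum_cons, map_mul]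
    refine (groupAlgebraFiltration K F').mul_mem ?_ (ih fun q hq => hl q (List.mem_cons_of_mem _ hq))
    rw [map_sub, map_one, groupAlgebraMap_of]
    exact of_sub_one_mem K (hf _ _ (hl p List.mem_cons_self))

section Conjugation

variable (F : GroupFiltration G) (N : Subgroup G) [N.Normal]

theorem groupAlgebraMap_conjNormal_mem (g : G) (n : ℕ) (a : MonoidAlgebra K N)
    (ha : a ∈ (groupAlgebraFiltration K (F.comap N.subtype)).term n) :
    groupAlgebraMap K (MulAut.conjNormal (H := N) g).toMonoidHom a ∈
      (groupAlgebraFiltration K (F.comap N.subtype)).term n :=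
  groupAlgebraMap_mem (fun i h hh => by
    have hN : (F.term i).Normal := inferInstance
    have := hN.conj_mem _ hh g
    rw [GroupFiltration.mem_comap]
    simpa using this) n a ha

/-- Conjugation by `g` on the group algebra of a normal subgroup shifts the filtration by `i` up to
the identity if `g ∈ F i`. -/
theorem groupAlgebraMap_conjNormal_sub_mem {i : ℕ+} {g : G} (hg : g ∈ F.term i) (n : ℕ)
    (a : MonoidAlgebra K N) (ha : a ∈ (groupAlgebraFiltration K (F.comap N.subtype)).term n) :
    groupAlgebraMap K (MulAut.conjNormal (H := N) g).toMonoidHom a - a ∈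
      (groupAlgebraFiltration K (F.comap N.subtype)).term (i + n) := by
  set C := groupAlgebraFiltration K (F.comap N.subtype) with hC
  set σ := groupAlgebraMap K (MulAut.conjNormal (H := N) g).toMonoidHom with hσ
  suffices h : C.term n ≤ (C.term (i + n)).comap (σ.toLinearMap - LinearMap.id) from h ha
  refine Submodule.span_le.2 ?_
  rintro _ ⟨l, hl, hn, rfl⟩
  refine C.antitone (Nat.add_le_add_left hn _) ?_
  change σ _ - (l.map fun p => MonoidAlgebra.of K N p.2 - 1).prod ∈ C.term _
  clear hn ha
  induction l with
  | nil => simp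
  | cons p l ih =>
    have hl' := fun q hq => hl q (List.mem_cons_of_mem _ hq)
    rw [List.map_cons, List.map_cons, List.prod_cons, List.sum_cons, map_mul]
    set y := (l.map fun p => MonoidAlgebra.of K N p.2 - 1).prod
    have hy : y ∈ C.term (l.map fun p => (p.1 : ℕ)).sum :=
      Submodule.subset_span ⟨l, hl', le_rfl, rfl⟩
    have hp := hl p List.mem_cons_self
    have hx : MonoidAlgebra.of K N p.2 - 1 ∈ C.term p.1 := of_sub_one_mem K hp
    -- On a single factor h - 1 the difference is ([g, h] - 1)h, which gains i degrees by the
    -- commutator condition on F.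
    have hx' : σ (MonoidAlgebra.of K N p.2 - 1) - (MonoidAlgebra.of K N p.2 - 1) ∈
        C.term (i + p.1) := by
      have hc : MulAut.conjNormal g p.2 * p.2⁻¹ ∈ (F.comap N.subtype).term (i + p.1) := by
        have := F.commutator_le i p.1 (Subgroup.commutator_mem_commutator hg hp)
        rw [GroupFiltration.mem_comap]
        simpa [commutatorElement_def] using this
      have := C.mul_mem_right (MonoidAlgebra.of K N p.2) (of_sub_one_mem K hc)
      rw [sub_mul, ← map_mul, inv_mul_cancel_right, one_mul] at this
      rw [map_sub, map_one, hσ, groupAlgebraMap_of, sub_sub_sub_cancel_right]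
      exact this
    -- Twisted Leibniz rule, which propagates the gain from the factors to the product.
    have e : ∀ x : MonoidAlgebra K N, σ x * σ y - x * y = (σ x - x) * σ y + x * (σ y - y) := by
      intro x; noncomm_ring
    rw [e]
    refine add_mem ?_ ?_
    · have := C.mul_mem hx' (groupAlgebraMap_conjNormal_mem F N g _ _ hy)
      rwa [add_assoc] at this
    · have := C.mul_mem hx (ih hl')
      rwa [add_left_comm] at this

variable (K) in
/-- Conjugation on the completed group algebra of a normal subgroup. -/
def completedConj (g : G) : CompletedGroupAlgebra K (F.comap N.subtype) →ₐ[K]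
    CompletedGroupAlgebra K (F.comap N.subtype) :=
  AlgFiltration.completionMap _ _ (groupAlgebraMap K (MulAut.conjNormal (H := N) g).toMonoidHom)
    (groupAlgebraMap_conjNormal_mem F N g)

variable (K) in
/-- The canonical map from a filtered group to the units of its completed group algebra. -/
def toUnits (F : GroupFiltration G) : G →* (CompletedGroupAlgebra K F)ˣ :=
  ((groupAlgebraFiltration K F).toCompletion.toMonoidHom.comp (MonoidAlgebra.of K G)).toHomUnits

theorem coe_toUnits (F : GroupFiltration G) (g : G) :
    (toUnits K F g : CompletedGroupAlgebra K F) =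
      (groupAlgebraFiltration K F).toCompletion (MonoidAlgebra.of K G g) :=
  rfl

theorem toUnits_mem (F : GroupFiltration G) {i : ℕ+} {g : G} (hg : g ∈ F.term i) :
    toUnits K F g ∈ (completedFiltration K F).oneUnits i := by
  rw [AlgFiltration.mem_oneUnits, coe_toUnits, ← map_one (groupAlgebraFiltration K F).toCompletion,
    ← map_sub]
  exact AlgFiltration.toCompletion_mem (of_sub_one_mem K hg)

variable {F N}

theorem completedConj_toUnits (g : G) (h : N) :
    completedConj K F N g (toUnits K (F.comap N.subtype) h) =
      toUnits K (F.comap N.subtype) (MulAut.conjNormal g h) := by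
  rw [coe_toUnits, coe_toUnits, completedConj, AlgFiltration.completionMap_toCompletion,
    groupAlgebraMap_of]
  rfl

theorem completedConj_mem (g : G) {n : ℕ} {x : CompletedGroupAlgebra K (F.comap N.subtype)}
    (hx : x ∈ (completedFiltration K (F.comap N.subtype)).term n) :
    completedConj K F N g x ∈ (completedFiltration K (F.comap N.subtype)).term n :=
  AlgFiltration.completionMap_mem _ hx

theorem completedConj_sub_mem {i : ℕ+} {g : G} (hg : g ∈ F.term i) {n : ℕ}
    {x : CompletedGroupAlgebra K (F.comap N.subtype)}
    (hx : x ∈ (completedFiltration K (F.comap N.subtype)).term n) :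
    completedConj K F N g x - x ∈ (completedFiltration K (F.comap N.subtype)).term (i + n) := by
  refine AlgFiltration.map_mem_of_dense (f := (completedConj K F N g).toLinearMap - LinearMap.id)
    (fun n x hx => sub_mem (completedConj_mem g hx) hx) (fun a ha => ?_) hx
  have := AlgFiltration.toCompletion_mem (groupAlgebraMap_conjNormal_sub_mem F N hg n a ha)
  rw [map_sub, ← AlgFiltration.completionMap_toCompletion
    (groupAlgebraMap_conjNormal_mem F N g)] at this
  exact this

theorem completedConj_mul (g g' : G) (x : CompletedGroupAlgebra K (F.comap N.subtype)) :
    completedConj K F N (g * g') x = completedConj K F N g (completedConj K F N g' x) := by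
  have := AlgFiltration.hom_ext_of_dense (f := (completedConj K F N (g * g')).toLinearMap)
    (g := (completedConj K F N g).toLinearMap.comp (completedConj K F N g').toLinearMap)
    (fun n x hx => completedConj_mem _ hx)
    (fun n x hx => completedConj_mem _ (completedConj_mem _ hx)) fun a => by
      induction a using MonoidAlgebra.induction_on with
      | of h =>
        change completedConj K F N (g * g') (toUnits K (F.comap N.subtype) h) =
          completedConj K F N g (completedConj K F N g' (toUnits K (F.comap N.subtype) h))
        simp only [completedConj_toUnits, map_mul, MulAut.mul_apply]
      | add a b ha hb => rw [map_add, map_add, map_add, ha, hb]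
      | smul r a ha => rw [map_smul, map_smul, map_smul, ha]
  exact LinearMap.congr_fun this x

/-- Conjugation by an element of N is inner. Hence x ↦ completedConj h x * h is left multiplication
by h, the formula that is later extended from N to G. -/
theorem completedConj_of_mem (h : N) (x : CompletedGroupAlgebra K (F.comap N.subtype)) :
    completedConj K F N h x * toUnits K (F.comap N.subtype) h =
      toUnits K (F.comap N.subtype) h * x := by
  have := AlgFiltration.hom_ext_of_dense
    (f := (LinearMap.mulRight K (toUnits K (F.comap N.subtype) h).val).comp
      (completedConj K F N h).toLinearMap)
    (g := LinearMap.mulLeft K (toUnits K (F.comap N.subtype) h).val)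
    (fun n x hx => AlgFiltration.mul_mem_right _ _ (completedConj_mem _ hx))
    (fun n x hx => AlgFiltration.mul_mem_left _ _ hx) fun a => by
      induction a using MonoidAlgebra.induction_on with
      | of h' =>
        change completedConj K F N h (toUnits K (F.comap N.subtype) h') *
          toUnits K (F.comap N.subtype) h = toUnits K (F.comap N.subtype) h *
            (toUnits K (F.comap N.subtype) h').val
        rw [completedConj_toUnits, ← Units.val_mul, ← Units.val_mul, ← map_mul, ← map_mul]
        congr 2
        ext
        simp
      | add a b ha hb => rw [map_add, map_add, map_add, ha, hb]
      | smul r a ha => rw [map_smul, map_smul, map_smul, ha]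
  exact LinearMap.congr_fun this x

end Conjugation

end GroupAlgebra


/-! ### Extending the regular representation of N to a cyclic extension. -/

section CyclicExtension

variable {K : Type*} [Field K] {G : Type*} [Group G] {F : GroupFiltration G}
  {N : Subgroup G} [N.Normal]

/-- The units of the completed group algebra of a normal subgroup which are fixed under conjugation
by `t` are fixed under conjugation by all powers of `t`. -/
theorem completedConj_zpow {t : G} {x : CompletedGroupAlgebra K (F.comap N.subtype)}
    (hx : completedConj K F N t x = x) (a : ℤ) : completedConj K F N (t ^ a) x = x := by
  have h1 : completedConj K F N 1 x = x := by
    simpa using completedConj_of_mem (K := K) (F := F) (1 : N) x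
  let S : Subgroup G :=
    { carrier := {g | completedConj K F N g x = x}
      mul_mem' := fun {g g'} hg hg' => by
        rw [Set.mem_ofPred_eq] at *
        rw [completedConj_mul, hg', hg]
      one_mem' := h1
      inv_mem' := fun {g} hg => by
        rw [Set.mem_ofPred_eq] at *
        conv_lhs => rw [← hg]
        rw [← completedConj_mul, inv_mul_cancel, h1] }
  exact S.zpow_mem (x := t) hx a

/-- In the completed group algebra of a normal subgroup `N`, there is a unit which behaves like a
given element `t` of the ambient group. -/
theorem exists_unit_zpow_eq [CharZero K] {w : ℕ+} (hw : F.term w = ⊤) (t : G) :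
    ∃ u : (CompletedGroupAlgebra K (F.comap N.subtype))ˣ,
      u ∈ (completedFiltration K (F.comap N.subtype)).oneUnits w ∧
      (∀ (a : ℤ) (h : t ^ a ∈ N), u ^ a = toUnits K (F.comap N.subtype) ⟨t ^ a, h⟩) ∧
      completedConj K F N t u = u := by
  set C := completedFiltration K (F.comap N.subtype) with hC
  have hmem : ∀ n : N, toUnits K (F.comap N.subtype) n ∈ C.oneUnits w := fun n =>
    toUnits_mem _ (by rw [GroupFiltration.mem_comap, hw]; trivial)
  have hle : C.oneUnits w ≤ C.oneUnits 1 := fun x hx => C.antitone (PNat.pos w) hx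
  by_cases ht : ∃ p : ℕ, 1 ≤ p ∧ t ^ p ∈ N
  · obtain ⟨p, hp, htp⟩ := ht
    -- If t^p ∈ N, the stand-in for t is the p-th root of t^p in the completed algebra. The other
    -- properties follow from uniqueness of p-th roots.
    obtain ⟨y, hy, hyp⟩ := AlgFiltration.exists_root _ hp (hle (hmem ⟨t ^ p, htp⟩))
    have hyu : IsUnit y := by
      refine AlgFiltration.isUnit_of_proj_one _ ?_
      rw [← sub_eq_zero, ← map_one ((groupAlgebraFiltration K (F.comap N.subtype)).proj 1),
        ← map_sub]
      exact AlgFiltration.mem_completionTerm.1 hy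
    obtain ⟨u, rfl⟩ := hyu
    have hup : u ^ p = toUnits K (F.comap N.subtype) ⟨t ^ p, htp⟩ := Units.ext (by
      rw [Units.val_pow_eq_pow_val, hyp])
    refine ⟨u, C.sub_one_mem_of_pow hp hy (by rw [hyp]; exact hmem _), fun a h => ?_, ?_⟩
    · refine Units.ext (AlgFiltration.eq_of_pow_eq_pow _ hp ((C.oneUnits 1).zpow_mem hy a)
        (hle (hmem _)) ?_)
      rw [← Units.val_pow_eq_pow_val, ← Units.val_pow_eq_pow_val, ← zpow_natCast, ← zpow_mul,
        mul_comm, zpow_mul, zpow_natCast, hup, ← map_zpow, ← map_pow]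
      congr 2
      ext
      simp only [Subgroup.coe_zpow, Subgroup.coe_pow]
      rw [← zpow_natCast, ← zpow_natCast, ← zpow_mul, ← zpow_mul, mul_comm]
    -- Conjugation by t fixes t^p, hence also its unique p-th root.
    · refine AlgFiltration.eq_of_pow_eq_pow _ hp ?_ hy ?_
      · have := completedConj_mem t hy
        rwa [map_sub, map_one] at this
      · rw [← map_pow, hyp, completedConj_toUnits]
        congr 2
        ext
        rw [MulAut.conjNormal_apply]
        simp only
        rw [← pow_succ', pow_succ, mul_inv_cancel_right]
  -- No nontrivial power of t lies in N, so there is no constraint and u = 1 works.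
  · refine ⟨1, one_mem _, fun a h => ?_, by simp⟩
    have ha : a = 0 := by
      by_contra hne
      refine ht ⟨a.natAbs, Int.natAbs_pos.2 hne, ?_⟩
      rcases Int.natAbs_eq a with h' | h'
      · rwa [h', zpow_natCast] at h
      · rw [h', zpow_neg, zpow_natCast] at h
        simpa using h
    subst ha
    have : (⟨t ^ (0 : ℤ), h⟩ : N) = 1 := by ext; simp
    rw [zpow_zero, this, map_one]

/-- If `G` is generated by a normal subgroup `N` and an element `t`, the canonical map from `N` to
the units of its completed group algebra extends to a crossed homomorphism on `G`. -/
theorem exists_crossedHom [CharZero K] {w : ℕ+} (hw : F.term w = ⊤) {t : G}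
    (ht : ∀ g : G, ∃ (n : N) (a : ℤ), g = n * t ^ a) :
    ∃ c : G → (CompletedGroupAlgebra K (F.comap N.subtype))ˣ,
      (∀ g, c g ∈ (completedFiltration K (F.comap N.subtype)).oneUnits w) ∧
      (∀ n : N, c n = toUnits K (F.comap N.subtype) n) ∧
      ∀ g g' : G, (c (g * g') : CompletedGroupAlgebra K (F.comap N.subtype)) =
        completedConj K F N g (c g') * c g := by
  obtain ⟨u, hu1, hu2, hu3⟩ := exists_unit_zpow_eq (K := K) (N := N) hw t
  choose ν α hνα using ht
  -- The crossed homomorphism is c(n t^a) = n u^a. It does not depend on the decomposition, because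
  -- u^b = t^b whenever t^b ∈ N.
  have hc : ∀ (n : N) (a : ℤ),
      toUnits K (F.comap N.subtype) (ν (n * t ^ a)) * u ^ α (n * t ^ a) =
        toUnits K (F.comap N.subtype) n * u ^ a := by
    intro n a
    have h := hνα (n * t ^ a)
    set n' := ν (n * t ^ a)
    set a' := α (n * t ^ a)
    have h1 : t ^ (a - a') = ((n⁻¹ * n' : N) : G) := by
      rw [zpow_sub, Subgroup.coe_mul, Subgroup.coe_inv, eq_inv_mul_iff_mul_eq, ← mul_assoc, h,
        mul_inv_cancel_right]
    have h2 : t ^ (a - a') ∈ N := h1 ▸ (n⁻¹ * n').2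
    have h3 := hu2 _ h2
    have h4 : (⟨t ^ (a - a'), h2⟩ : N) = n⁻¹ * n' := Subtype.ext h1
    rw [h4, map_mul, map_inv, zpow_sub, eq_inv_mul_iff_mul_eq, ← mul_assoc] at h3
    rw [← h3, inv_mul_cancel_right]
  refine ⟨fun g => toUnits K (F.comap N.subtype) (ν g) * u ^ α g, fun g => ?_, fun n => ?_,
    fun g g' => ?_⟩
  · refine mul_mem (toUnits_mem _ ?_) (zpow_mem hu1 _)
    rw [GroupFiltration.mem_comap, hw]
    trivial
  · have := hc n 0
    simpa using this
  · have e : g * g' = ((ν g * MulAut.conjNormal (t ^ α g) (ν g') : N) : G) * t ^ (α g + α g') := by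
      conv_lhs => rw [hνα g, hνα g']
      rw [Subgroup.coe_mul, MulAut.conjNormal_apply, zpow_add]
      group
    have h1 : completedConj K F N (t ^ α g) ((u ^ α g' :
        (CompletedGroupAlgebra K (F.comap N.subtype))ˣ) : CompletedGroupAlgebra K (F.comap N.subtype)) =
        (u ^ α g' : (CompletedGroupAlgebra K (F.comap N.subtype))ˣ) := by
      refine completedConj_zpow ?_ _
      have h2 : Units.map (completedConj K F N t : _ →* _) u = u := Units.ext hu3
      exact congrArg Units.val ((map_zpow _ u (α g')).trans (congrArg (· ^ α g') h2))
    have h2 : ∀ x, completedConj K F N g x =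
        completedConj K F N (ν g) (completedConj K F N (t ^ α g) x) := fun x => by
      rw [← completedConj_mul, ← hνα g]
    simp only
    rw [e, hc, Units.val_mul _ (u ^ α g'), h2, map_mul (completedConj K F N (t ^ α g)),
      h1, completedConj_toUnits,
      Units.val_mul _ (u ^ α g), ← mul_assoc, completedConj_of_mem]
    rw [zpow_add, (Commute.refl u).zpow_zpow (α g) (α g'), map_mul]
    simp only [Units.val_mul, mul_assoc]

/-- If `G` is generated by `N` and an element `t`, then the filtration of the group algebra of `N`
detects the elements `h - 1`, `h ∈ N`, as well as that of the group algebra of `G`. -/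
theorem mem_term_of_cyclic_extension [CharZero K] {w : ℕ+} (hw : F.term w = ⊤)
    (hN : F.term (w + 1) ≤ N) {t : G} (ht : ∀ g : G, ∃ (n : N) (a : ℤ), g = n * t ^ a) {n : ℕ} {h : N}
    (hh : MonoidAlgebra.of K G h - 1 ∈ (groupAlgebraFiltration K F).term n) :
    MonoidAlgebra.of K N h - 1 ∈ (groupAlgebraFiltration K (F.comap N.subtype)).term n := by
  obtain ⟨c, hc1, hc2, hc3⟩ := exists_crossedHom (K := K) hw ht
  set C := completedFiltration K (F.comap N.subtype) with hC
  have hci : ∀ (i : ℕ+) (g : G), g ∈ F.term i → c g ∈ C.oneUnits i := by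
    intro i g hg
    -- For i ≤ w the bound c(g) ∈ 1 + F_w is enough; for i > w the element g already lies in N,
    -- where c is the canonical map.
    rcases le_or_gt i w with hi | hi
    · exact C.antitone hi (hc1 g)
    · have hgN : g ∈ N := hN (F.antitone (PNat.add_one_le_iff.2 hi) hg)
      have := hc2 ⟨g, hgN⟩
      rw [this]
      exact toUnits_mem _ hg
  have h1 : ∀ x, completedConj K F N 1 x = x := fun x => by
    simpa using completedConj_of_mem (K := K) (F := F) (1 : N) x
  -- The action g · x = (g x g⁻¹) c(g). On N it is left multiplication, so applying h - 1 to the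
  -- vector 1 returns the image of h - 1 in the completion of K[N].
  let ρ : G →* Module.End K (CompletedGroupAlgebra K (F.comap N.subtype)) :=
    { toFun := fun g => (LinearMap.mulRight K (c g).val).comp (completedConj K F N g).toLinearMap
      map_one' := by
        ext x
        have := hc2 1
        rw [map_one] at this
        change completedConj K F N 1 x * c 1 = x
        rw [h1, ← Subgroup.coe_one N, this, Units.val_one, mul_one]
      map_mul' := fun g g' => by
        ext x
        change completedConj K F N (g * g') x * c (g * g') =
          completedConj K F N g (completedConj K F N g' x * c g') * c g
        rw [hc3, completedConj_mul, map_mul, mul_assoc] }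
  have hρ : ∀ (i : ℕ+) (g : G), g ∈ F.term i → ∀ (j : ℕ), ∀ v ∈ C.term j,
      ρ g v - v ∈ C.term (i + j) := by
    intro i g hg j v hv
    have e : ρ g v - v = (completedConj K F N g v - v) * c g + v * ((c g).val - 1) := by
      change completedConj K F N g v * c g - v = _
      noncomm_ring
    rw [e]
    refine add_mem (C.mul_mem_right _ (completedConj_sub_mem hg hv)) ?_
    rw [add_comm]
    exact C.mul_mem hv (hci i g hg)
  have := lift_mem_of_mem_term F C.term C.antitone ρ hρ hh (C.mem_term_zero 1)
  rw [map_sub, map_one (MonoidAlgebra.lift K _ G ρ), MonoidAlgebra.lift_of] at this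
  have e : (ρ h - 1) 1 = (groupAlgebraFiltration K (F.comap N.subtype)).toCompletion
      (MonoidAlgebra.of K N h - 1) := by
    change completedConj K F N h 1 * c h - 1 = _
    rw [map_one, one_mul, hc2, coe_toUnits, map_sub, map_one]
  rw [e, add_zero] at this
  exact AlgFiltration.toCompletion_mem_iff.1 this

end CyclicExtension


/-! ### Dimension subgroups in characteristic zero. -/

section DimensionSubgroups

variable {K : Type*} [Field K] {G H J : Type*} [Group G] [Group H] [Group J]

theorem groupAlgebraMap_comp_apply (f : G →* H) (f' : H →* J) (a : MonoidAlgebra K G) :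
    groupAlgebraMap K f' (groupAlgebraMap K f a) = groupAlgebraMap K (f'.comp f) a := by
  induction a using MonoidAlgebra.induction_on with
  | of g => simp only [groupAlgebraMap_of, MonoidHom.comp_apply]
  | add a b ha hb => simp only [map_add, ha, hb]
  | smul r a ha => simp only [map_smul, ha]

theorem groupAlgebraMap_injective {f : G →* H} (hf : Function.Injective f) :
    Function.Injective (groupAlgebraMap K f) := by
  have e : groupAlgebraMap K f = MonoidAlgebra.mapDomainAlgHom K K f := by
    ext g
    simp [groupAlgebraMap]
  rw [e]
  exact MonoidAlgebra.mapDomain_injective hf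

variable (K) in
/-- The element `g` of the subgroup `L` belongs to the `n`-th dimension subgroup of `L` for the
filtration induced by `F`. -/
def MemDimension (F : GroupFiltration G) (n : ℕ) (L : Subgroup G) (g : G) : Prop :=
  ∃ h : g ∈ L, MonoidAlgebra.of K L ⟨g, h⟩ - 1 ∈
    (groupAlgebraFiltration K (F.comap L.subtype)).term n

variable {F : GroupFiltration G} {n : ℕ}

theorem MemDimension.mono {L L' : Subgroup G} (h : L ≤ L') {g : G} (hg : MemDimension K F n L g) :
    MemDimension K F n L' g := by
  obtain ⟨hgL, hg⟩ := hg
  refine ⟨h hgL, ?_⟩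
  have := groupAlgebraMap_mem (F' := F.comap L'.subtype) (f := Subgroup.inclusion h)
    (fun i x hx => hx) _ _ hg
  rwa [map_sub, map_one, groupAlgebraMap_of] at this

/-- An element of the filtration of the group algebra comes from a finitely generated subgroup. -/
theorem exists_finset_groupAlgebraMap_eq {a : MonoidAlgebra K G}
    (ha : a ∈ (groupAlgebraFiltration K F).term n) :
    ∃ (s : Finset G), ∃ b ∈ (groupAlgebraFiltration K
      (F.comap (Subgroup.closure (s : Set G)).subtype)).term n,
      groupAlgebraMap K (Subgroup.closure (s : Set G)).subtype b = a := by
  classical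
  have hmono : ∀ {s s' : Finset G} (_ : s ⊆ s') {a : MonoidAlgebra K G} {n : ℕ},
      (∃ b ∈ (groupAlgebraFiltration K (F.comap (Subgroup.closure (s : Set G)).subtype)).term n,
        groupAlgebraMap K (Subgroup.closure (s : Set G)).subtype b = a) →
      ∃ b ∈ (groupAlgebraFiltration K (F.comap (Subgroup.closure (s' : Set G)).subtype)).term n,
        groupAlgebraMap K (Subgroup.closure (s' : Set G)).subtype b = a := by
    rintro s s' h a n ⟨b, hb, rfl⟩
    have hle : Subgroup.closure (s : Set G) ≤ Subgroup.closure (s' : Set G) :=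
      Subgroup.closure_mono (by exact_mod_cast h)
    refine ⟨groupAlgebraMap K (Subgroup.inclusion hle) b,
      groupAlgebraMap_mem (fun i x hx => hx) _ _ hb, ?_⟩
    rw [groupAlgebraMap_comp_apply]
    rfl
  have hlist : ∀ l : List (ℕ+ × G), (∀ p ∈ l, p.2 ∈ F.term p.1) → ∃ (s : Finset G),
      ∃ b ∈ (groupAlgebraFiltration K (F.comap (Subgroup.closure (s : Set G)).subtype)).term
        (l.map fun p => (p.1 : ℕ)).sum,
      groupAlgebraMap K (Subgroup.closure (s : Set G)).subtype b =
        (l.map fun p => MonoidAlgebra.of K G p.2 - 1).prod := by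
    intro l hl
    induction l with
    | nil => exact ⟨∅, 1, AlgFiltration.mem_term_zero _ _, by simp⟩
    | cons p l ih =>
      obtain ⟨s, hs⟩ := ih fun q hq => hl q (List.mem_cons_of_mem _ hq)
      obtain ⟨b, hb, hb'⟩ := hmono (Finset.subset_insert p.2 s) hs
      have hp : p.2 ∈ Subgroup.closure ((insert p.2 s : Finset G) : Set G) :=
        Subgroup.subset_closure (by simp)
      refine ⟨insert p.2 s, (MonoidAlgebra.of K _ ⟨p.2, hp⟩ - 1) * b, ?_, ?_⟩
      · rw [List.map_cons, List.sum_cons]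
        exact AlgFiltration.mul_mem _ (of_sub_one_mem K (hl p List.mem_cons_self)) hb
      · rw [map_mul, hb', map_sub, map_one, groupAlgebraMap_of, List.map_cons, List.prod_cons]
        rfl
  refine Submodule.span_induction ?_ ?_ ?_ ?_ ha
  · rintro _ ⟨l, hl, hn, rfl⟩
    obtain ⟨s, b, hb, hb'⟩ := hlist l hl
    exact ⟨s, b, AlgFiltration.antitone _ hn hb, hb'⟩
  · exact ⟨∅, 0, zero_mem _, map_zero _⟩
  · rintro a a' _ _ ⟨s, hs⟩ ⟨s', hs'⟩
    obtain ⟨b, hb, hb'⟩ := hmono (Finset.subset_union_left (s₂ := s')) hs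
    obtain ⟨c, hc, hc'⟩ := hmono (Finset.subset_union_right (s₁ := s)) hs'
    exact ⟨s ∪ s', b + c, add_mem hb hc, by rw [map_add, hb', hc']⟩
  · rintro r a _ ⟨s, b, hb, hb'⟩
    exact ⟨s, r • b, Submodule.smul_mem _ _ hb, by rw [map_smul, hb']⟩

/-- An expression witnessing membership of g - 1 involves only finitely many group elements.
Adjoining g to them makes g - 1 an element of the smaller group algebra, which embeds in K[G]. -/
theorem exists_finset_memDimension {g : G}
    (hg : MonoidAlgebra.of K G g - 1 ∈ (groupAlgebraFiltration K F).term n) :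
    ∃ s : Finset G, MemDimension K F n (Subgroup.closure (s : Set G)) g := by
  classical
  obtain ⟨s, b, hb, hb'⟩ := exists_finset_groupAlgebraMap_eq hg
  have hle : Subgroup.closure (s : Set G) ≤ Subgroup.closure ((insert g s : Finset G) : Set G) :=
    Subgroup.closure_mono (by simp)
  have hgs : g ∈ Subgroup.closure ((insert g s : Finset G) : Set G) :=
    Subgroup.subset_closure (by simp)
  refine ⟨insert g s, hgs, ?_⟩
  have e : MonoidAlgebra.of K _ ⟨g, hgs⟩ - 1 = groupAlgebraMap K (Subgroup.inclusion hle) b := by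
    refine groupAlgebraMap_injective (Subgroup.subtype_injective _) ?_
    rw [groupAlgebraMap_comp_apply, map_sub, map_one, groupAlgebraMap_of]
    exact hb'.symm
  rw [e]
  exact groupAlgebraMap_mem (fun i x hx => hx) _ _ hb

variable [CharZero K]

/-- All commutators of G lie in F_{2w} ⊆ F_{w+1} ⊆ L. So L is normal and L ⊔ ⟨t⟩ is a cyclic
extension of it, to which `mem_term_of_cyclic_extension` applies. -/
theorem MemDimension.of_sup_zpowers {w : ℕ+} (hw : F.term w = ⊤) {L : Subgroup G}
    (hL : F.term (w + 1) ≤ L) {t g : G} (hg : g ∈ L)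
    (h : MemDimension K F n (L ⊔ Subgroup.zpowers t) g) : MemDimension K F n L g := by
  have hcomm : ∀ x y : G, ⁅x, y⁆ ∈ L := fun x y => hL <|
    F.antitone (by gcongr; exact one_le) <| F.commutator_le w w <|
      Subgroup.commutator_mem_commutator (by simp [hw]) (by simp [hw])
  have hLn : L.Normal := ⟨fun x hx y => by
    simpa [commutatorElement_def] using L.mul_mem (hcomm y x) hx⟩
  set L' := L ⊔ Subgroup.zpowers t with hL'
  have hle : L ≤ L' := le_sup_left
  have htL' : t ∈ L' := Subgroup.mem_sup_right (Subgroup.mem_zpowers t)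
  obtain ⟨hg', h⟩ := h
  have ht : ∀ x : L', ∃ (y : L.subgroupOf L') (a : ℤ), x = y * (⟨t, htL'⟩ : L') ^ a := by
    intro x
    obtain ⟨y, hy, z, ⟨a, rfl⟩, hyz⟩ := Subgroup.mem_sup_of_normal_left.1 x.2
    exact ⟨⟨⟨y, hle hy⟩, hy⟩, a, Subtype.ext hyz.symm⟩
  have key := mem_term_of_cyclic_extension (F := F.comap L'.subtype) (N := L.subgroupOf L')
    (w := w) (h := ⟨⟨g, hg'⟩, hg⟩) (by
      ext x
      rw [GroupFiltration.mem_comap, hw]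
      simp) (fun x hx => hL hx) ht h
  refine ⟨hg, ?_⟩
  have := groupAlgebraMap_mem (F' := F.comap L.subtype)
    (f := (Subgroup.subgroupOfEquivOfLe hle).toMonoidHom) (fun i x hx => hx) _ _ key
  rwa [map_sub, map_one, groupAlgebraMap_of] at this

/-- If `F w` is the whole group, then the dimension subgroups of `F (w + 1)` for the induced
filtration are the intersections with the dimension subgroups of the group. -/
theorem memDimension_succ {w : ℕ+} (hw : F.term w = ⊤) {g : G} (hg : g ∈ F.term (w + 1))
    (h : MonoidAlgebra.of K G g - 1 ∈ (groupAlgebraFiltration K F).term n) :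
    MemDimension K F n (F.term (w + 1)) g := by
  classical
  obtain ⟨s, hs⟩ := exists_finset_memDimension h
  replace hs := hs.mono (le_sup_right : _ ≤ F.term (w + 1) ⊔ _)
  -- Start from the subgroup generated by F_{w+1} and a finite set, and discard the generators one
  -- by one.
  induction s using Finset.induction_on with
  | empty => simpa using hs
  | insert t s _ ih =>
    rw [Finset.coe_insert, Set.insert_eq, Set.union_comm, Subgroup.closure_union,
      ← Subgroup.zpowers_eq_closure, ← sup_assoc] at hs
    exact ih (hs.of_sup_zpowers hw le_sup_left (Subgroup.mem_sup_left hg))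

/-- A normal subgroup with abelian quotient is separated by homomorphisms to `ℚ` from the elements
none of whose powers it contains. -/
theorem exists_hom_rat_ne_zero {N : Subgroup G} [N.Normal] (hN : commutator G ≤ N) {g : G}
    (hg : ∀ k : ℕ, 1 ≤ k → g ^ k ∉ N) :
    ∃ l : G → ℚ, (∀ x y, l (x * y) = l x + l y) ∧ (∀ x ∈ N, l x = 0) ∧ l g ≠ 0 := by
  let _ : CommGroup (G ⧸ N) :=
    { (inferInstance : Group (G ⧸ N)) with
      mul_comm := fun a b => by
        induction a using QuotientGroup.induction_on
        induction b using QuotientGroup.induction_on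
        rename_i a b
        rw [← QuotientGroup.mk_mul, ← QuotientGroup.mk_mul, QuotientGroup.eq]
        refine hN ?_
        have : ⁅b⁻¹, a⁻¹⁆ ∈ commutator G :=
          Subgroup.commutator_mem_commutator (Subgroup.mem_top _) (Subgroup.mem_top _)
        simpa [commutatorElement_def, mul_assoc] using this }
  -- No power of g dies in G/N, so ℤ embeds there via g; the inclusion ℤ → ℚ then extends because ℚ
  -- is divisible, hence injective.
  let f : ℤ →+ Additive (G ⧸ N) := zmultiplesHom _ (Additive.ofMul (g : G ⧸ N))
  have hf : Function.Injective f := by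
    refine (injective_iff_map_eq_zero f).2 fun a ha => ?_
    by_contra hne
    have h1 : ((g ^ a : G) : G ⧸ N) = 1 := by
      rw [QuotientGroup.mk_zpow]
      exact congrArg Additive.toMul ha
    rw [QuotientGroup.eq_one_iff] at h1
    refine hg a.natAbs (Int.natAbs_pos.2 hne) ?_
    rcases Int.natAbs_eq a with h' | h'
    · rwa [h', zpow_natCast] at h1
    · rw [h', zpow_neg, zpow_natCast] at h1
      simpa using h1
  obtain ⟨h, hh⟩ := (Module.Baer.of_divisible ℚ).extension_property_addMonoidHom f hf
    (Int.castAddHom ℚ)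
  refine ⟨fun x => h (Additive.ofMul (x : G ⧸ N)), fun x y => ?_, fun x hx => ?_, ?_⟩
  · beta_reduce
    rw [QuotientGroup.mk_mul, ofMul_mul, map_add]
  · beta_reduce
    rw [(QuotientGroup.eq_one_iff x).2 hx, ofMul_one, map_zero]
  · have := DFunLike.congr_fun hh 1
    simp only [f, AddMonoidHom.comp_apply, zmultiplesHom_apply, one_smul, Int.coe_castAddHom,
      Int.cast_one] at this
    exact this.trans_ne one_ne_zero

/-- Otherwise a homomorphism l to ℚ kills F_{w+1} but not g. It gives a unipotent representation on
K² in which F_n K[G] acts by zero for n > w, while g - 1 sends (1, 0) to (0, l(g)) ≠ 0. -/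
theorem exists_pow_mem_of_sub_one_mem {w : ℕ+} (hw : F.term w = ⊤) (hn : (w : ℕ) < n) {g : G}
    (h : MonoidAlgebra.of K G g - 1 ∈ (groupAlgebraFiltration K F).term n) :
    ∃ k : ℕ, 1 ≤ k ∧ g ^ k ∈ F.term (w + 1) := by
  by_contra! hg
  have hN : commutator G ≤ F.term (w + 1) := by
    refine le_trans ?_ (F.antitone (by gcongr; exact one_le : w + 1 ≤ w + w))
    have := F.commutator_le w w
    rwa [hw] at this
  obtain ⟨l, hl1, hl2, hl3⟩ := exists_hom_rat_ne_zero hN hg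
  let ρ : G →* Module.End K (K × K) :=
    { toFun := fun x => LinearMap.prod (LinearMap.fst K K K)
        (LinearMap.snd K K K + (l x : K) • LinearMap.fst K K K)
      map_one' := by
        refine LinearMap.ext fun v => Prod.ext rfl ?_
        simp [hl2 1 (one_mem _)]
      map_mul' := fun x y => by
        refine LinearMap.ext fun v => Prod.ext rfl ?_
        simp [hl1]
        ring }
  have hρ : ∀ (x : G) (v : K × K), ρ x v - v = (0, (l x : K) * v.1) := fun x v => by
    refine Prod.ext ?_ ?_ <;> simp [ρ]
  -- The plane has one vector of degree 0 and one of degree w: elements of F_i with i ≤ w push the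
  -- former into the line of the latter, and elements of F_{w+1} act trivially.
  let C : ℕ → Submodule K (K × K) := fun j =>
    if j = 0 then ⊤ else if j ≤ w then LinearMap.ker (LinearMap.fst K K K) else ⊥
  have hC : Antitone C := by
    refine antitone_nat_of_succ_le fun j => ?_
    rcases Nat.eq_zero_or_pos j with rfl | hj
    · simp [C]
    · by_cases hjw : j + 1 ≤ w
      · simp [C, hjw, hj.ne', (Nat.le_succ j).trans hjw]
      · simp [C, hjw]
  have key := lift_mem_of_mem_term (n := n) (j := 0) (v := (1, 0)) F C hC ρ (fun i x hx j v hv => by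
    rw [hρ]
    rcases lt_or_ge w i with hi | hi
    · rw [hl2 x (F.antitone (PNat.add_one_le_iff.2 hi) hx)]
      rw [Rat.cast_zero, zero_mul]
      exact zero_mem (C (i + j))
    · have hi' : (i : ℕ) ≤ w := hi
      have hi0 := i.pos
      rcases Nat.eq_zero_or_pos j with rfl | hj
      · simp [C, hi']
      · have hv1 : v.1 = 0 := by
          have := hC hj hv
          have h1 : (1 : ℕ) ≤ w := w.pos
          simpa [C, h1] using this
        rw [hv1]
        rw [mul_zero]
        exact zero_mem (C (i + j))) h (by simp [C])
  rw [map_sub, map_one (MonoidAlgebra.lift K _ G ρ), MonoidAlgebra.lift_of, LinearMap.sub_apply,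
    Module.End.one_apply, hρ] at key
  have hn0 : n ≠ 0 := by omega
  have hnw : ¬ n ≤ w := by omega
  simp [C, hn0, hnw] at key
  exact hl3 key

/-- The dimension subgroups of a filtered group over a field of characteristic zero consist of
elements having a power in the filtration. -/
theorem exists_pow_mem_term {i : ℕ+} {g : G}
    (hg : MonoidAlgebra.of K G g - 1 ∈ (groupAlgebraFiltration K F).term i) :
    ∃ k : ℕ, 1 ≤ k ∧ g ^ k ∈ F.term i := by
  -- Descent: some power of g lies in F_w and still satisfies the dimension condition for F_w with
  -- its induced filtration. The case w = i is the claim.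
  suffices h : ∀ w : ℕ+, w ≤ i → ∃ k : ℕ, 1 ≤ k ∧ MemDimension K F i (F.term w) (g ^ k) by
    obtain ⟨k, hk, h, -⟩ := h i le_rfl
    exact ⟨k, hk, h⟩
  intro w
  induction w using PNat.recOn with
  | one =>
    intro _
    refine ⟨1, le_rfl, ?_⟩
    rw [F.term_one, pow_one]
    refine ⟨Subgroup.mem_top _, ?_⟩
    have := groupAlgebraMap_mem (F' := F.comap (⊤ : Subgroup G).subtype)
      (f := Subgroup.topEquiv.symm.toMonoidHom) (fun i x hx => hx) _ _ hg
    rwa [map_sub, map_one, groupAlgebraMap_of] at this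
  | succ w ih =>
    intro hwi
    obtain ⟨k, hk, h, hgk⟩ := ih ((PNat.lt_add_right w 1).le.trans hwi)
    set F' := F.comap (F.term w).subtype with hF'
    have hw : F'.term w = ⊤ := by
      ext x
      simp [hF', GroupFiltration.mem_comap]
    obtain ⟨m, hm, hgm⟩ := exists_pow_mem_of_sub_one_mem hw (PNat.add_one_le_iff.1 hwi) hgk
    have hgkm : MonoidAlgebra.of K _ ((⟨g ^ k, h⟩ : F.term w) ^ m) - 1 ∈
        (groupAlgebraFiltration K F').term i := by
      rw [map_pow]
      exact AlgFiltration.pow_sub_one_mem _ hgk m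
    obtain ⟨h', hg'⟩ := memDimension_succ hw hgm hgkm
    refine ⟨k * m, Nat.mul_pos hk hm, by rw [pow_mul]; exact hgm, ?_⟩
    have := groupAlgebraMap_mem (F' := F.comap (F.term (w + 1)).subtype)
      (f := ((F.term w).subtype.comp (F'.term (w + 1)).subtype).codRestrict (F.term (w + 1))
        fun x => x.2) (fun i x hx => hx) _ _ hg'
    rw [map_sub, map_one, groupAlgebraMap_of] at this
    convert this using 4
    exact pow_mul g k m

end DimensionSubgroups

namespace AlgFiltration

/-! ### Linear sections and degree operators over a field. -/

section Field

variable {K A B : Type*} [Field K] [Ring A] [Algebra K A] [Ring B] [Algebra K B]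

/-- Over a field A → A/F_n splits linearly, which gives a map inverting A → Â modulo F_n. It serves
to pull statements about tensor products of completions back to A ⊗ B. -/
theorem exists_linearMap_section (F : AlgFiltration K A) (n : ℕ) :
    ∃ s : F.completion →ₗ[K] A, ∀ x, F.toCompletion (s x) - x ∈ F.completionFiltration.term n := by
  obtain ⟨s, hs⟩ := (Ideal.Quotient.mkₐ K (F.ideal n)).toLinearMap.exists_rightInverse_of_surjective
    (LinearMap.range_eq_top.2 (F.mk_surjective n))
  refine ⟨s.comp (F.proj n).toLinearMap, fun x => mem_completionTerm.2 ?_⟩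
  rw [map_sub, proj_toCompletion, sub_eq_zero]
  exact LinearMap.congr_fun hs (F.proj n x)

theorem linearMap_section_mem {F : AlgFiltration K A} {n : ℕ} {s : F.completion →ₗ[K] A}
    (hs : ∀ x, F.toCompletion (s x) - x ∈ F.completionFiltration.term n) (p : ℕ) (hp : p ≤ n)
    (x : F.completion) (hx : x ∈ F.completionFiltration.term p) : s x ∈ F.term p := by
  rw [← toCompletion_mem_iff]
  have := add_mem (F.completionFiltration.antitone hp (hs x)) hx
  rwa [sub_add_cancel] at this

/-- The filtration of a tensor product of filtered algebras is induced by the filtration of the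
tensor product of their completions. -/
theorem mem_tensor_of_map_toCompletion_mem {F : AlgFiltration K A} {F' : AlgFiltration K B} {n : ℕ}
    {x : A ⊗[K] B}
    (hx : Algebra.TensorProduct.map F.toCompletion F'.toCompletion x ∈
      (F.completionFiltration.tensor F'.completionFiltration).term n) :
    x ∈ (F.tensor F').term n := by
  obtain ⟨s, hs⟩ := F.exists_linearMap_section n
  obtain ⟨s', hs'⟩ := F'.exists_linearMap_section n
  have h1 : TensorProduct.map s s' (Algebra.TensorProduct.map F.toCompletion F'.toCompletion x) ∈
      (F.tensor F').term n := by
    have h : tensorTerm F.completionFiltration F'.completionFiltration n ≤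
        ((F.tensor F').term n).comap (TensorProduct.map s s') :=
      tensorTerm_le fun i j hij a ha b hb => by
        rw [Submodule.mem_comap, TensorProduct.map_tmul]
        exact tmul_mem_tensorTerm hij (linearMap_section_mem hs i (by omega) a ha)
          (linearMap_section_mem hs' j (by omega) b hb)
    exact h hx
  have h2 : ∀ y : A ⊗[K] B,
      TensorProduct.map s s' (Algebra.TensorProduct.map F.toCompletion F'.toCompletion y) - y ∈
        (F.tensor F').term n := by
    intro y
    induction y with
    | zero => simp
    | tmul a b =>
      have ha : s (F.toCompletion a) - a ∈ F.term n := by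
        rw [← toCompletion_mem_iff, map_sub]
        exact hs _
      have hb : s' (F'.toCompletion b) - b ∈ F'.term n := by
        rw [← toCompletion_mem_iff, map_sub]
        exact hs' _
      have e : s (F.toCompletion a) ⊗ₜ[K] s' (F'.toCompletion b) - a ⊗ₜ[K] b =
          (s (F.toCompletion a) - a) ⊗ₜ[K] s' (F'.toCompletion b) +
            a ⊗ₜ[K] (s' (F'.toCompletion b) - b) := by
        rw [TensorProduct.sub_tmul, TensorProduct.tmul_sub]; abel
      rw [Algebra.TensorProduct.map_tmul, TensorProduct.map_tmul, e]
      exact add_mem (tmul_mem_tensorTerm (add_zero n) ha (F'.mem_term_zero _))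
        (tmul_mem_tensorTerm (zero_add n) (F.mem_term_zero _) hb)
    | add y z hy hz =>
      rw [map_add, map_add, add_sub_add_comm]
      exact add_mem hy hz
  have := sub_mem h1 (h2 x)
  rwa [sub_sub_cancel] at this

/-- There is a linear endomorphism of a filtered vector space which acts on the `p`-th graded piece
as multiplication by `p`, for all `p ≤ J`. -/
theorem exists_degree_operator (F : AlgFiltration K A) (J : ℕ) :
    ∃ Y : A →ₗ[K] A, (∀ p, ∀ a ∈ F.term p, Y a ∈ F.term p) ∧
      ∀ p ≤ J, ∀ a ∈ F.term p, Y a - (p : K) • a ∈ F.term (p + 1) := by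
  suffices h : ∃ Y : A →ₗ[K] A, (∀ p, ∀ a ∈ F.term p, Y a ∈ F.term p) ∧
      (∀ p ≤ J, ∀ a ∈ F.term p, Y a - (p : K) • a ∈ F.term (p + 1)) ∧
      -- The extra clause makes the induction run: Y is exactly the scalar J on all of F_J.
      ∀ a ∈ F.term J, Y a = (J : K) • a from
    let ⟨Y, h1, h2, _⟩ := h
    ⟨Y, h1, h2⟩
  induction J with
  | zero =>
    refine ⟨0, fun p a _ => zero_mem _, fun p hp a _ => ?_, fun a _ => by simp⟩
    obtain rfl : p = 0 := by omega
    simp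
  | succ J ih =>
    obtain ⟨Y, hY1, hY2, hY3⟩ := ih
    -- Adding a linear projection P onto F_{J+1} raises the scalar there from J to J + 1 and changes
    -- nothing modulo F_{J+1}. So Y is the sum of projections onto F_1, …, F_J.
    obtain ⟨P, hP⟩ := (F.term (J + 1)).subtype.exists_leftInverse_of_injective
      (Submodule.ker_subtype _)
    have hP1 : ∀ a ∈ F.term (J + 1), (P a : A) = a := fun a ha =>
      congrArg Subtype.val (LinearMap.congr_fun hP ⟨a, ha⟩)
    have hY4 : ∀ a ∈ F.term (J + 1), Y a + P a = ((J + 1 : ℕ) : K) • a := fun a ha => by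
      rw [hP1 a ha, hY3 a (F.antitone J.le_succ ha), Nat.cast_succ, add_smul, one_smul]
    refine ⟨Y + (F.term (J + 1)).subtype.comp P, fun p a ha => ?_, fun p hp a ha => ?_, hY4⟩
    · refine add_mem (hY1 p a ha) ?_
      rcases le_or_gt (J + 1) p with h | h
      · rw [LinearMap.comp_apply, Submodule.subtype_apply, hP1 a (F.antitone h ha)]
        exact ha
      · exact F.antitone h.le (P a).2
    · change Y a + P a - _ ∈ _
      rcases hp.eq_or_lt with rfl | h
      · rw [hY4 a ha, sub_self]
        exact zero_mem _
      · rw [add_sub_right_comm]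
        exact add_mem (hY2 p (by omega) a ha) (F.antitone h (P a).2)

end Field

end AlgFiltration

/-! ### The Dynkin operator on the group algebra. -/

section Dynkin

variable {K : Type*} [Field K] {G : Type*} [Group G] {F : GroupFiltration G}

theorem antipode_of (g : G) :
    HopfAlgebra.antipode K (MonoidAlgebra.of K G g) = MonoidAlgebra.of K G g⁻¹ := by
  simp [MonoidAlgebra.of_apply, MonoidAlgebra.antipode_single]

theorem antipode_mul_eq (a b : MonoidAlgebra K G) :
    HopfAlgebra.antipode K (a * b) = HopfAlgebra.antipode K b * HopfAlgebra.antipode K a := by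
  induction a using MonoidAlgebra.induction_on with
  | of g =>
    induction b using MonoidAlgebra.induction_on with
    | of h => rw [← map_mul, antipode_of, antipode_of, antipode_of, mul_inv_rev, map_mul]
    | add b c hb hc => simp only [mul_add, add_mul, map_add, hb, hc]
    | smul r b hb => simp only [mul_smul_comm, smul_mul_assoc, map_smul, hb]
  | add a c ha hc => simp only [mul_add, add_mul, map_add, ha, hc]
  | smul r a ha => simp only [mul_smul_comm, smul_mul_assoc, map_smul, ha]

theorem antipode_one_eq : HopfAlgebra.antipode K (1 : MonoidAlgebra K G) = 1 := by
  rw [← map_one (MonoidAlgebra.of K G), antipode_of, inv_one]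

theorem antipode_mem {n : ℕ} {a : MonoidAlgebra K G}
    (ha : a ∈ (groupAlgebraFiltration K F).term n) :
    HopfAlgebra.antipode K a ∈ (groupAlgebraFiltration K F).term n := by
  suffices h : (groupAlgebraFiltration K F).term n ≤
      ((groupAlgebraFiltration K F).term n).comap (HopfAlgebra.antipode K) from h ha
  refine Submodule.span_le.2 ?_
  rintro _ ⟨l, hl, hn, rfl⟩
  change HopfAlgebra.antipode K _ ∈ (groupAlgebraFiltration K F).term n
  refine (groupAlgebraFiltration K F).antitone hn ?_
  clear hn ha
  induction l with
  | nil => exact (groupAlgebraFiltration K F).mem_term_zero _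
  | cons p l ih =>
    rw [List.map_cons, List.map_cons, List.prod_cons, List.sum_cons, antipode_mul_eq, add_comm]
    refine (groupAlgebraFiltration K F).mul_mem (ih fun q hq => hl q (List.mem_cons_of_mem _ hq)) ?_
    rw [map_sub, antipode_one_eq, antipode_of]
    exact of_sub_one_mem K (inv_mem (hl p List.mem_cons_self))

theorem comul_of (g : G) : Bialgebra.comulAlgHom K (MonoidAlgebra K G) (MonoidAlgebra.of K G g) =
    MonoidAlgebra.of K G g ⊗ₜ[K] MonoidAlgebra.of K G g := by
  simp

/-- The coproduct of the group algebra of a filtered group preserves the filtrations. -/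
theorem comul_mem {n : ℕ} {a : MonoidAlgebra K G}
    (ha : a ∈ (groupAlgebraFiltration K F).term n) :
    Bialgebra.comulAlgHom K (MonoidAlgebra K G) a ∈
      ((groupAlgebraFiltration K F).tensor (groupAlgebraFiltration K F)).term n :=
  AlgFiltration.mem_tensor_of_map_toCompletion_mem (comulToCompleted_mem K F n a ha)

/-- The bilinear map `a ⊗ b ↦ S a * Y b`, where `S` is the antipode of the group algebra. -/
def antipodeMul (Y : MonoidAlgebra K G →ₗ[K] MonoidAlgebra K G) :
    MonoidAlgebra K G ⊗[K] MonoidAlgebra K G →ₗ[K] MonoidAlgebra K G :=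
  LinearMap.mul' K (MonoidAlgebra K G) ∘ₗ TensorProduct.map (HopfAlgebra.antipode K) Y

theorem antipodeMul_tmul (Y : MonoidAlgebra K G →ₗ[K] MonoidAlgebra K G) (a b : MonoidAlgebra K G) :
    antipodeMul Y (a ⊗ₜ[K] b) = HopfAlgebra.antipode K a * Y b :=
  rfl

theorem antipodeMul_mem {Y : MonoidAlgebra K G →ₗ[K] MonoidAlgebra K G}
    (hY : ∀ p, ∀ a ∈ (groupAlgebraFiltration K F).term p, Y a ∈ (groupAlgebraFiltration K F).term p)
    {n : ℕ} {x : MonoidAlgebra K G ⊗[K] MonoidAlgebra K G}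
    (hx : x ∈ ((groupAlgebraFiltration K F).tensor (groupAlgebraFiltration K F)).term n) :
    antipodeMul Y x ∈ (groupAlgebraFiltration K F).term n := by
  have h : AlgFiltration.tensorTerm (groupAlgebraFiltration K F) (groupAlgebraFiltration K F) n ≤
      ((groupAlgebraFiltration K F).term n).comap (antipodeMul Y) :=
    AlgFiltration.tensorTerm_le fun i j hij a ha b hb => by
      subst hij
      exact (groupAlgebraFiltration K F).mul_mem (antipode_mem ha) (hY j b hb)
  exact h hx

/-- The Dynkin operator `S * Y` of the group algebra. -/
def dynkin (Y : MonoidAlgebra K G →ₗ[K] MonoidAlgebra K G) :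
    MonoidAlgebra K G →ₗ[K] MonoidAlgebra K G :=
  antipodeMul Y ∘ₗ (Bialgebra.comulAlgHom K (MonoidAlgebra K G)).toLinearMap

theorem antipodeMul_id_comul (a : MonoidAlgebra K G) :
    antipodeMul LinearMap.id (Bialgebra.comulAlgHom K (MonoidAlgebra K G) a) =
      Bialgebra.counitAlgHom K (MonoidAlgebra K G) a • 1 := by
  induction a using MonoidAlgebra.induction_on with
  | of g =>
    rw [comul_of, antipodeMul_tmul, antipode_of, LinearMap.id_apply, ← map_mul, inv_mul_cancel]
    simp [MonoidAlgebra.one_def]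
  | add a b ha hb => simp only [map_add, add_smul, ha, hb]
  | smul r a ha => simp only [map_smul, smul_assoc, ha]

variable {J : ℕ} {Y : MonoidAlgebra K G →ₗ[K] MonoidAlgebra K G}

/-- In the associated graded algebra x = h - 1 is primitive of degree q, S(x) = -x, and Y satisfies
Y(bx) = Y(b)x + q bx. Expanding S * Y on (a ⊗ b)(x ⊗ 1 + 1 ⊗ x) therefore gives the commutator of
S(a)Y(b) with x, plus q S(a)bx. -/
theorem antipodeMul_mul_sub_mem
    (hY1 : ∀ p, ∀ a ∈ (groupAlgebraFiltration K F).term p, Y a ∈ (groupAlgebraFiltration K F).term p)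
    (hY2 : ∀ p ≤ J, ∀ a ∈ (groupAlgebraFiltration K F).term p,
      Y a - (p : K) • a ∈ (groupAlgebraFiltration K F).term (p + 1))
    {p : ℕ} {q : ℕ+} (hpq : p + q ≤ J) {h : G} (hh : h ∈ F.term q)
    {t : MonoidAlgebra K G ⊗[K] MonoidAlgebra K G}
    (ht : t ∈ ((groupAlgebraFiltration K F).tensor (groupAlgebraFiltration K F)).term p) :
    antipodeMul Y (t * MonoidAlgebra.of K G h ⊗ₜ[K] MonoidAlgebra.of K G h) - antipodeMul Y t -
      (antipodeMul Y t * (MonoidAlgebra.of K G h - 1) -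
        (MonoidAlgebra.of K G h - 1) * antipodeMul Y t) -
      ((q : ℕ) : K) • (antipodeMul LinearMap.id t * (MonoidAlgebra.of K G h - 1)) ∈
        (groupAlgebraFiltration K F).term (p + q + 1) := by
  set C := groupAlgebraFiltration K F with hC
  set x := MonoidAlgebra.of K G h - 1 with hx
  set x' := MonoidAlgebra.of K G h⁻¹ - 1 with hx'
  have hxq : x ∈ C.term q := of_sub_one_mem K hh
  have hxq' : x' ∈ C.term q := of_sub_one_mem K (inv_mem hh)
  have hxx : x + x' = -(x' * x) := by
    rw [hx, hx', sub_mul, mul_sub, ← map_mul, inv_mul_cancel, map_one]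
    noncomm_ring
  have hoh : MonoidAlgebra.of K G h = 1 + x := by rw [hx]; abel
  have hoh' : MonoidAlgebra.of K G h⁻¹ = 1 + x' := by rw [hx']; abel
  have hq := q.pos
  let f : MonoidAlgebra K G ⊗[K] MonoidAlgebra K G →ₗ[K] MonoidAlgebra K G :=
    antipodeMul Y ∘ₗ LinearMap.mulRight K (MonoidAlgebra.of K G h ⊗ₜ[K] MonoidAlgebra.of K G h) -
      antipodeMul Y - (LinearMap.mulRight K x ∘ₗ antipodeMul Y - LinearMap.mulLeft K x ∘ₗ antipodeMul Y)
      - ((q : ℕ) : K) • (LinearMap.mulRight K x ∘ₗ antipodeMul LinearMap.id)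
  suffices hf : AlgFiltration.tensorTerm C C p ≤ (C.term (p + q + 1)).comap f from hf ht
  refine AlgFiltration.tensorTerm_le fun i j hij a ha b hb => ?_
  change antipodeMul Y (a ⊗ₜ[K] b * MonoidAlgebra.of K G h ⊗ₜ[K] MonoidAlgebra.of K G h) -
    antipodeMul Y (a ⊗ₜ[K] b) - (antipodeMul Y (a ⊗ₜ[K] b) * x - x * antipodeMul Y (a ⊗ₜ[K] b)) -
      ((q : ℕ) : K) • (antipodeMul LinearMap.id (a ⊗ₜ[K] b) * x) ∈ C.term (p + q + 1)
  rw [Algebra.TensorProduct.tmul_mul_tmul, antipodeMul_tmul, antipodeMul_tmul, antipodeMul_tmul,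
    antipode_mul_eq, antipode_of, LinearMap.id_apply, hoh, hoh', mul_add b, mul_one, map_add]
  set s := HopfAlgebra.antipode K a
  have hs : s ∈ C.term i := antipode_mem ha
  have hbx : b * x ∈ C.term (j + q) := C.mul_mem hb hxq
  have h1 := hY2 (j + q) (by omega) _ hbx
  have h2 := C.mul_mem (hY2 j (by omega) b hb) hxq
  -- Y is a derivation up to higher order: bx has degree j + q and b has degree j, so the scalars
  -- differ by q.
  have h3 : Y (b * x) - Y b * x - ((q : ℕ) : K) • (b * x) ∈ C.term (j + q + 1) := by
    have := sub_mem h1 (C.antitone (by omega : j + q + 1 ≤ j + 1 + q) h2)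
    convert this using 1
    rw [Nat.cast_add, add_smul, sub_mul, smul_mul_assoc]
    abel
  have e : (1 + x') * s * (Y b + Y (b * x)) - s * Y b - (s * Y b * x - x * (s * Y b)) -
      ((q : ℕ) : K) • (s * b * x) =
      s * (Y (b * x) - Y b * x - ((q : ℕ) : K) • (b * x)) + x' * (s * Y (b * x)) +
        (x + x') * (s * Y b) := by
    rw [mul_sub s, mul_smul_comm, mul_assoc s b x]
    noncomm_ring
  rw [e, hxx]
  refine add_mem (add_mem ?_ ?_) ?_
  · exact C.antitone (by omega) (C.mul_mem hs h3)
  · exact C.antitone (by omega) (C.mul_mem hxq' (C.mul_mem hs (hY1 _ _ hbx)))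
  · rw [neg_mul]
    exact neg_mem (C.antitone (by omega) (C.mul_mem (C.mul_mem hxq' hxq) (C.mul_mem hs (hY1 _ _ hb))))

end Dynkin


/-! ### Primitive elements are combinations of elements g - 1. -/

section Primitive

variable {K : Type*} [Field K] {G : Type*} [Group G] {F : GroupFiltration G}

variable (K F) in
/-- The span of the elements `g - 1`, `g ∈ F p`, and of the next term of the filtration. -/
def liePart (p : ℕ) : Submodule K (MonoidAlgebra K G) :=
  Submodule.span K {x | ∃ (i : ℕ+) (g : G), (i : ℕ) = p ∧ g ∈ F.term i ∧
    x = MonoidAlgebra.of K G g - 1} ⊔ (groupAlgebraFiltration K F).term (p + 1)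

theorem of_sub_one_mem_liePart {i : ℕ+} {g : G} (hg : g ∈ F.term i) :
    MonoidAlgebra.of K G g - 1 ∈ liePart K F i :=
  Submodule.mem_sup_left (Submodule.subset_span ⟨i, g, rfl, hg, rfl⟩)

theorem term_succ_le_liePart (p : ℕ) : (groupAlgebraFiltration K F).term (p + 1) ≤ liePart K F p :=
  le_sup_right

/-- The commutator of g - 1 and h - 1 is gh - hg = ([g, h] - 1)hg, which equals [g, h] - 1 up to the
next term. -/
theorem commutator_mem_liePart {p : ℕ} {q : ℕ+} {h : G} (hh : h ∈ F.term q)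
    {y : MonoidAlgebra K G} (hy : y ∈ liePart K F p) :
    y * (MonoidAlgebra.of K G h - 1) - (MonoidAlgebra.of K G h - 1) * y ∈
      liePart K F (p + q) := by
  set C := groupAlgebraFiltration K F with hC
  set x := MonoidAlgebra.of K G h - 1 with hx
  have hxq : x ∈ C.term q := of_sub_one_mem K hh
  suffices h : liePart K F p ≤ (liePart K F (p + q)).comap
      (LinearMap.mulRight K x - LinearMap.mulLeft K x) from h hy
  refine sup_le (Submodule.span_le.2 ?_) fun y hy => ?_
  · rintro _ ⟨i, g, rfl, hg, rfl⟩
    change (MonoidAlgebra.of K G g - 1) * x - x * (MonoidAlgebra.of K G g - 1) ∈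
      liePart K F (i + q)
    have hc : ⁅g, h⁆ ∈ F.term (i + q) :=
      F.commutator_le i q (Subgroup.commutator_mem_commutator hg hh)
    have h1 : MonoidAlgebra.of K G ⁅g, h⁆ - 1 ∈ C.term (i + q) := by
      rw [← PNat.add_coe]; exact of_sub_one_mem K hc
    have h2 : MonoidAlgebra.of K G (h * g) - 1 ∈ C.term 1 :=
      of_sub_one_mem (i := 1) K (by simp [F.term_one])
    have e : (MonoidAlgebra.of K G g - 1) * x - x * (MonoidAlgebra.of K G g - 1) =
        (MonoidAlgebra.of K G ⁅g, h⁆ - 1) +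
          (MonoidAlgebra.of K G ⁅g, h⁆ - 1) * (MonoidAlgebra.of K G (h * g) - 1) := by
      have e1 : MonoidAlgebra.of K G g * MonoidAlgebra.of K G h =
          MonoidAlgebra.of K G ⁅g, h⁆ * MonoidAlgebra.of K G (h * g) := by
        rw [← map_mul, ← map_mul, commutatorElement_def]
        congr 1
        group
      have e2 : (MonoidAlgebra.of K G g - 1) * x - x * (MonoidAlgebra.of K G g - 1) =
          MonoidAlgebra.of K G g * MonoidAlgebra.of K G h -
            MonoidAlgebra.of K G h * MonoidAlgebra.of K G g := by
        rw [hx]; noncomm_ring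
      rw [e2, e1, ← map_mul _ h g]
      noncomm_ring
    rw [e]
    have h3 := of_sub_one_mem_liePart (K := K) hc
    rw [PNat.add_coe] at h3
    exact add_mem h3 (term_succ_le_liePart _ (C.mul_mem h1 h2))
  · change y * x - x * y ∈ liePart K F (p + q)
    refine term_succ_le_liePart _ (sub_mem ?_ ?_)
    · exact C.antitone (by omega) (C.mul_mem hy hxq)
    · exact C.antitone (by omega) (C.mul_mem hxq hy)

variable {J : ℕ} {Y : MonoidAlgebra K G →ₗ[K] MonoidAlgebra K G}

/-- The recursion S * Y (ax) ≡ [S * Y (a), x] + q ε(a) x: take t = Δa in `antipodeMul_mul_sub_mem`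
and use S * id = ε. -/
theorem dynkin_mul_sub_mem
    (hY1 : ∀ p, ∀ a ∈ (groupAlgebraFiltration K F).term p, Y a ∈ (groupAlgebraFiltration K F).term p)
    (hY2 : ∀ p ≤ J, ∀ a ∈ (groupAlgebraFiltration K F).term p,
      Y a - (p : K) • a ∈ (groupAlgebraFiltration K F).term (p + 1))
    {p : ℕ} {q : ℕ+} (hpq : p + q ≤ J) {h : G} (hh : h ∈ F.term q) {a : MonoidAlgebra K G}
    (ha : a ∈ (groupAlgebraFiltration K F).term p) :
    dynkin Y (a * (MonoidAlgebra.of K G h - 1)) -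
      (dynkin Y a * (MonoidAlgebra.of K G h - 1) - (MonoidAlgebra.of K G h - 1) * dynkin Y a) -
      (((q : ℕ) : K) * Bialgebra.counitAlgHom K (MonoidAlgebra K G) a) •
        (MonoidAlgebra.of K G h - 1) ∈ (groupAlgebraFiltration K F).term (p + q + 1) := by
  have := antipodeMul_mul_sub_mem hY1 hY2 hpq hh (comul_mem ha)
  rw [← comul_of, ← map_mul, antipodeMul_id_comul, smul_mul_assoc, one_mul, smul_smul] at this
  rw [mul_sub a, mul_one, map_sub]
  exact this

/-- The Dynkin operator maps products of elements `g - 1` to Lie elements. -/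
theorem dynkin_prod_mem
    (hY1 : ∀ p, ∀ a ∈ (groupAlgebraFiltration K F).term p, Y a ∈ (groupAlgebraFiltration K F).term p)
    (hY2 : ∀ p ≤ J, ∀ a ∈ (groupAlgebraFiltration K F).term p,
      Y a - (p : K) • a ∈ (groupAlgebraFiltration K F).term (p + 1))
    (l : List (ℕ+ × G)) (hl : ∀ p ∈ l, p.2 ∈ F.term p.1)
    (hJ : (l.map fun p => (p.1 : ℕ)).sum ≤ J) :
    dynkin Y (l.map fun p => MonoidAlgebra.of K G p.2 - 1).prod ∈
      liePart K F (l.map fun p => (p.1 : ℕ)).sum := by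
  -- The recursion peels off the rightmost factor. For the empty product the value is Y 1, which
  -- lies in F_1 because Y acts as 0 in degree 0.
  induction l using List.reverseRecOn with
  | nil =>
    have h := hY2 0 (Nat.zero_le J) 1 ((groupAlgebraFiltration K F).mem_term_zero 1)
    rw [Nat.cast_zero, zero_smul, sub_zero] at h
    have e : dynkin Y 1 = Y 1 := by
      rw [dynkin, LinearMap.comp_apply, AlgHom.toLinearMap_apply, map_one,
        Algebra.TensorProduct.one_def, antipodeMul_tmul, antipode_one_eq, one_mul]
    rw [List.map_nil, List.map_nil, List.prod_nil, e]
    exact term_succ_le_liePart _ h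
  | append_singleton l p ih =>
    have hl' : ∀ q ∈ l, q.2 ∈ F.term q.1 := fun q hq => hl q (List.mem_append_left _ hq)
    have hp : p.2 ∈ F.term p.1 := hl p (by simp)
    simp only [List.map_append, List.map_cons, List.map_nil, List.prod_append, List.sum_append,
      List.prod_singleton, List.sum_singleton] at hJ ⊢
    have h1 := ih hl' (by omega)
    set a := (l.map fun p => MonoidAlgebra.of K G p.2 - 1).prod with ha'
    set n := (l.map fun p => (p.1 : ℕ)).sum with hn
    have ha : a ∈ (groupAlgebraFiltration K F).term n :=
      Submodule.subset_span ⟨l, hl', le_rfl, rfl⟩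
    have h2 := term_succ_le_liePart _ (dynkin_mul_sub_mem hY1 hY2 hJ hp ha)
    have h3 := commutator_mem_liePart hp h1
    have h4 : (((p.1 : ℕ) : K) * Bialgebra.counitAlgHom K (MonoidAlgebra K G) a) •
        (MonoidAlgebra.of K G p.2 - 1) ∈ liePart K F (n + p.1) := by
      -- The counit term survives only for a one-letter product; otherwise a lies in the
      -- augmentation ideal.
      rcases l with _ | ⟨q, l⟩
      · have hn0 : n = 0 := by simp [hn]
        rw [hn0, zero_add]
        exact Submodule.smul_mem _ _ (of_sub_one_mem_liePart hp)
      · have hn1 : 1 ≤ n := by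
          have := q.1.pos
          simp only [hn, List.map_cons, List.sum_cons]
          omega
        rw [counit_eq_zero K F a (AlgFiltration.antitone _ hn1 ha), mul_zero, zero_smul]
        exact zero_mem _
    have := add_mem (add_mem h2 h4) h3
    rwa [sub_add_cancel, sub_add_cancel] at this

/-- Products of weight exactly J become Lie elements, and heavier ones stay in F_{J+1} because Δ, S
and Y preserve the filtrations. -/
theorem dynkin_mem
    (hY1 : ∀ p, ∀ a ∈ (groupAlgebraFiltration K F).term p, Y a ∈ (groupAlgebraFiltration K F).term p)
    (hY2 : ∀ p ≤ J, ∀ a ∈ (groupAlgebraFiltration K F).term p,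
      Y a - (p : K) • a ∈ (groupAlgebraFiltration K F).term (p + 1))
    {a : MonoidAlgebra K G} (ha : a ∈ (groupAlgebraFiltration K F).term J) :
    dynkin Y a ∈ liePart K F J := by
  suffices h : (groupAlgebraFiltration K F).term J ≤ (liePart K F J).comap (dynkin Y) from h ha
  refine Submodule.span_le.2 ?_
  rintro _ ⟨l, hl, hn, rfl⟩
  rcases hn.eq_or_lt with rfl | hn
  · exact dynkin_prod_mem hY1 hY2 l hl le_rfl
  · refine term_succ_le_liePart _ (antipodeMul_mem hY1 (comul_mem ?_))
    exact Submodule.subset_span ⟨l, hl, hn, rfl⟩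

/-- The primitive elements of the associated graded algebra of the group algebra of a filtered group
are spanned by the classes of the elements `g - 1`. -/
theorem mem_liePart_of_primitive [CharZero K] (hJ : 1 ≤ J) {a : MonoidAlgebra K G}
    (ha : a ∈ (groupAlgebraFiltration K F).term J)
    (hΔ : Bialgebra.comulAlgHom K (MonoidAlgebra K G) a - (a ⊗ₜ[K] 1 + 1 ⊗ₜ[K] a) ∈
      ((groupAlgebraFiltration K F).tensor (groupAlgebraFiltration K F)).term (J + 1)) :
    a ∈ liePart K F J := by
  obtain ⟨Y, hY1, hY2⟩ := (groupAlgebraFiltration K F).exists_degree_operator J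
  -- Primitivity turns S * Y (a) into S(a)Y(1) + Y(a), that is, J a modulo F_{J+1}. Since S * Y (a)
  -- is also a Lie element, it remains to divide by J.
  have h1 := antipodeMul_mem hY1 hΔ
  rw [map_sub, map_add, antipodeMul_tmul, antipodeMul_tmul, antipode_one_eq, one_mul] at h1
  have h2 : Y 1 ∈ (groupAlgebraFiltration K F).term 1 := by
    simpa using hY2 0 (Nat.zero_le J) 1 ((groupAlgebraFiltration K F).mem_term_zero 1)
  have h3 := (groupAlgebraFiltration K F).mul_mem (antipode_mem ha) h2
  have h4 := add_mem (add_mem h1 h3) (hY2 J le_rfl a ha)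
  have h5 := sub_mem (dynkin_mem hY1 hY2 ha) (term_succ_le_liePart _ h4)
  have e : dynkin Y a - (antipodeMul Y (Bialgebra.comulAlgHom K (MonoidAlgebra K G) a) -
      (HopfAlgebra.antipode K a * Y 1 + Y a) + HopfAlgebra.antipode K a * Y 1 +
        (Y a - (J : K) • a)) = (J : K) • a := by
    change antipodeMul Y (Bialgebra.comulAlgHom K (MonoidAlgebra K G) a) - _ = _
    abel
  rw [e] at h5
  exact (Submodule.smul_mem_iff _ (Nat.cast_ne_zero.2 (by omega))).1 h5

theorem of_mul_sub_one_sub_mem {i : ℕ+} {g h : G} (hg : g ∈ F.term i) (hh : h ∈ F.term i) :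
    (MonoidAlgebra.of K G (g * h) - 1) -
      ((MonoidAlgebra.of K G g - 1) + (MonoidAlgebra.of K G h - 1)) ∈
        (groupAlgebraFiltration K F).term (i + 1) := by
  have e : (MonoidAlgebra.of K G (g * h) - 1) -
      ((MonoidAlgebra.of K G g - 1) + (MonoidAlgebra.of K G h - 1)) =
      (MonoidAlgebra.of K G g - 1) * (MonoidAlgebra.of K G h - 1) := by
    rw [map_mul]; noncomm_ring
  have := i.pos
  rw [e]
  exact AlgFiltration.antitone _ (by omega)
    (AlgFiltration.mul_mem _ (of_sub_one_mem K hg) (of_sub_one_mem K hh))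

theorem of_zpow_sub_one_sub_mem {i : ℕ+} {g : G} (hg : g ∈ F.term i) (k : ℤ) :
    (MonoidAlgebra.of K G (g ^ k) - 1) - (k : K) • (MonoidAlgebra.of K G g - 1) ∈
      (groupAlgebraFiltration K F).term (i + 1) := by
  induction k using Int.induction_on with
  | zero => simp [MonoidAlgebra.one_def]
  | succ k ih =>
    have := add_mem (of_mul_sub_one_sub_mem (K := K) (zpow_mem hg k) hg) ih
    rw [zpow_add_one]
    convert this using 1
    rw [Int.cast_add, Int.cast_one, add_smul, one_smul]
    abel
  | pred k ih =>
    have := sub_mem ih (of_mul_sub_one_sub_mem (K := K) (zpow_mem hg (-k - 1)) hg)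
    rw [← zpow_add_one, sub_add_cancel] at this
    convert this using 1
    rw [Int.cast_sub, Int.cast_one, sub_smul, one_smul]
    abel

/-- Rational combinations of elements `g - 1` have a multiple of the form `g - 1` modulo the next
term of the filtration. -/
theorem exists_nsmul_sub_mem_of_mem_liePart {i : ℕ+} {a : MonoidAlgebra ℚ G}
    (ha : a ∈ liePart ℚ F i) : ∃ (m : ℕ) (h : G), 1 ≤ m ∧ h ∈ F.term i ∧
      (m : ℚ) • a - (MonoidAlgebra.of ℚ G h - 1) ∈ (groupAlgebraFiltration ℚ F).term (i + 1) := by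
  obtain ⟨b, hb, c, hc, rfl⟩ := Submodule.mem_sup.1 ha
  suffices H : ∃ (m : ℕ) (h : G), 1 ≤ m ∧ h ∈ F.term i ∧
      (m : ℚ) • b - (MonoidAlgebra.of ℚ G h - 1) ∈ (groupAlgebraFiltration ℚ F).term (i + 1) by
    obtain ⟨m, h, hm, hh, H⟩ := H
    refine ⟨m, h, hm, hh, ?_⟩
    rw [smul_add, add_sub_right_comm]
    exact add_mem H (Submodule.smul_mem _ _ hc)
  clear ha hc
  induction hb using Submodule.span_induction with
  | mem x hx =>
    obtain ⟨j, g, hj, hg, rfl⟩ := hx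
    obtain rfl : j = i := PNat.coe_injective hj
    exact ⟨1, g, le_rfl, hg, by simp⟩
  | zero => exact ⟨1, 1, le_rfl, one_mem _, by simp [MonoidAlgebra.one_def]⟩
  | add x y _ _ hx hy =>
    obtain ⟨m, g, hm, hg, hx⟩ := hx
    obtain ⟨n, h, hn, hh, hy⟩ := hy
    have h1 := of_zpow_sub_one_sub_mem (K := ℚ) hg n
    have h2 := of_zpow_sub_one_sub_mem (K := ℚ) hh m
    have h3 := of_mul_sub_one_sub_mem (K := ℚ) (zpow_mem hg n) (zpow_mem hh m)
    have h4 := Submodule.smul_mem _ (n : ℚ) hx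
    have h5 := Submodule.smul_mem _ (m : ℚ) hy
    -- Common denominator mn; on the graded piece g ↦ g - 1 turns products into sums and powers into
    -- multiples.
    refine ⟨m * n, g ^ (n : ℤ) * h ^ (m : ℤ), Nat.mul_pos hm hn,
      mul_mem (zpow_mem hg _) (zpow_mem hh _), ?_⟩
    have := sub_mem (sub_mem (sub_mem (add_mem h4 h5) h1) h2) h3
    convert this using 1
    simp only [smul_sub, smul_add, smul_smul, Nat.cast_mul, Int.cast_natCast, mul_comm (n : ℚ)]
    abel
  | smul r x _ hx =>
    obtain ⟨m, g, hm, hg, hx⟩ := hx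
    have h1 := of_zpow_sub_one_sub_mem (K := ℚ) hg r.num
    have h2 := Submodule.smul_mem _ (r.num : ℚ) hx
    refine ⟨r.den * m, g ^ r.num, Nat.mul_pos r.den_pos hm, zpow_mem hg _, ?_⟩
    have := sub_mem h2 h1
    convert this using 1
    have e : (r.den : ℚ) * m * r = r.num * m := by
      rw [mul_right_comm, mul_comm (r.den : ℚ), Rat.mul_den_eq_num]
    rw [smul_smul, Nat.cast_mul, e, smul_sub, smul_smul]
    abel

end Primitive


/-! ### Elements of a nilpotent group with a power in a subgroup. -/

section Isolator

theorem commutatorElement_mul_left {X : Type*} [Group X] (a b c : X) :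
    ⁅a * b, c⁆ = a * ⁅b, c⁆ * a⁻¹ * ⁅a, c⁆ := by
  simp only [commutatorElement_def]; group

theorem commutatorElement_mul_right {X : Type*} [Group X] (a b c : X) :
    ⁅a, b * c⁆ = ⁅a, b⁆ * (b * ⁅a, c⁆ * b⁻¹) := by
  simp only [commutatorElement_def]; group

theorem conj_eq_of_mem_center {X : Type*} [Group X] {z : X} (hz : z ∈ Subgroup.center X) (a : X) :
    a * z * a⁻¹ = z := by
  rw [Subgroup.mem_center_iff.1 hz a, mul_inv_cancel_right]

theorem commutatorElement_pow_left {X : Type*} [Group X] {a b : X}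
    (h : ⁅a, b⁆ ∈ Subgroup.center X) (n : ℕ) : ⁅a ^ n, b⁆ = ⁅a, b⁆ ^ n := by
  induction n with
  | zero => simp
  | succ n ih => rw [pow_succ, commutatorElement_mul_left, conj_eq_of_mem_center h, ih, pow_succ']

theorem commutatorElement_pow_right {X : Type*} [Group X] {a b : X}
    (h : ⁅a, b⁆ ∈ Subgroup.center X) (n : ℕ) : ⁅a, b ^ n⁆ = ⁅a, b⁆ ^ n := by
  induction n with
  | zero => simp
  | succ n ih =>
    rw [pow_succ', commutatorElement_mul_right, ih, conj_eq_of_mem_center (pow_mem h n), pow_succ']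

/-- The central elements having a power in `S`. -/
def centralIsolator {X : Type*} [Group X] (S : Subgroup X) : Subgroup X where
  carrier := {z | z ∈ Subgroup.center X ∧ ∃ k : ℕ, 1 ≤ k ∧ z ^ k ∈ S}
  mul_mem' := by
    rintro z z' ⟨hz, k, hk, hzk⟩ ⟨hz', l, hl, hzl⟩
    refine ⟨mul_mem hz hz', k * l, Nat.mul_pos hk hl, ?_⟩
    have hc : Commute z z' := (Subgroup.mem_center_iff.1 hz z').symm
    rw [hc.mul_pow, pow_mul, mul_comm k l, pow_mul]
    exact mul_mem (pow_mem hzk l) (pow_mem hzl k)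
  one_mem' := ⟨one_mem _, 1, le_rfl, by simp⟩
  inv_mem' := by
    rintro z ⟨hz, k, hk, hzk⟩
    exact ⟨inv_mem hz, k, hk, by rw [inv_pow]; exact inv_mem hzk⟩

theorem lowerCentralSeries_quotient {X : Type*} [Group X] (Z : Subgroup X) [Z.Normal] (n : ℕ) :
    (⊤ : Subgroup (X ⧸ Z)).lowerCentralSeries n =
      ((⊤ : Subgroup X).lowerCentralSeries n).map (QuotientGroup.mk' Z) := by
  rw [Subgroup.map_lowerCentralSeries, ← MonoidHom.range_eq_map, QuotientGroup.range_mk']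

/-- If a nilpotent group is generated by elements having powers in a subgroup `S`, all its elements
have powers in `S`. -/
theorem exists_pow_mem_of_closure_eq_top {n : ℕ} : ∀ {X : Type u} [Group X] {S : Subgroup X}
    {E : Set X}, (⊤ : Subgroup X).lowerCentralSeries n = ⊥ → Subgroup.closure E = ⊤ →
    (∀ e ∈ E, ∃ k : ℕ, 1 ≤ k ∧ e ^ k ∈ S) → ∀ x : X, ∃ k : ℕ, 1 ≤ k ∧ x ^ k ∈ S := by
  induction n with
  | zero =>
    intro X _ S E hX hE hES x
    have hx : x ∈ (⊤ : Subgroup X) := Subgroup.mem_top x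
    rw [← Subgroup.lowerCentralSeries_zero (⊤ : Subgroup X), hX, Subgroup.mem_bot] at hx
    exact ⟨1, le_rfl, by simp [hx]⟩
  | succ n ih =>
    intro X _ S E hX hE hES x
    -- The last nontrivial layer of the lower central series is central. Induction handles X/Z, so
    -- every element has a power in S Z, and it remains to treat Z.
    set Z := (⊤ : Subgroup X).lowerCentralSeries n with hZ
    have hZc : Z ≤ Subgroup.center X := by
      rw [Subgroup.lowerCentralSeries_succ] at hX
      intro z hz
      refine Subgroup.mem_center_iff.2 fun y => ?_
      have := Subgroup.commutator_mem_commutator hz (Subgroup.mem_top y)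
      rw [hX, Subgroup.mem_bot, commutatorElement_eq_one_iff_mul_comm] at this
      exact this.symm
    have hquot : ∀ y : X, ∃ k : ℕ, 1 ≤ k ∧ ∃ s ∈ S, ∃ z ∈ Z, y ^ k = s * z := by
      intro y
      have hE' : Subgroup.closure (QuotientGroup.mk' Z '' E) = ⊤ := by
        rw [← MonoidHom.map_closure, hE, ← MonoidHom.range_eq_map, QuotientGroup.range_mk']
      obtain ⟨k, hk, s, hs, hsk⟩ := ih (X := X ⧸ Z) (S := S.map (QuotientGroup.mk' Z))
        (by rw [lowerCentralSeries_quotient, ← hZ, Subgroup.map_eq_bot_iff, QuotientGroup.ker_mk'])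
        hE' (by
          rintro _ ⟨e, he, rfl⟩
          obtain ⟨k, hk, hek⟩ := hES e he
          exact ⟨k, hk, by rw [← map_pow]; exact Subgroup.mem_map_of_mem _ hek⟩)
        (QuotientGroup.mk' Z y)
      rw [← map_pow] at hsk
      exact ⟨k, hk, s, hs, s⁻¹ * y ^ k, QuotientGroup.eq.1 hsk, by rw [mul_inv_cancel_left]⟩
    have hZS : Z ≤ centralIsolator S := by
      -- For n = 0 the group is abelian and the generators suffice. Otherwise Z is generated by
      -- commutators [a, b], which are central and multiplicative in b, so b may be taken to be a
      -- generator e.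
      rcases n with _ | m
      · have hc : ∀ y : X, y ∈ Subgroup.center X := fun y => hZc (by rw [hZ]; exact Subgroup.mem_top y)
        refine le_top.trans ?_
        rw [← hE, Subgroup.closure_le]
        exact fun e he => ⟨hc e, hES e he⟩
      · rw [hZ, Subgroup.lowerCentralSeries_succ] at *
        refine Subgroup.commutator_le.2 fun a ha b hb' => ?_
        clear hb'
        have hab : ∀ c, ⁅a, c⁆ ∈ Subgroup.center X := fun c =>
          hZc (Subgroup.commutator_mem_commutator ha (Subgroup.mem_top c))
        have hb : b ∈ Subgroup.closure E := hE ▸ Subgroup.mem_top b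
        induction hb using Subgroup.closure_induction with
        | mem e he =>
          obtain ⟨k, hk, hek⟩ := hES e he
          obtain ⟨l, hl, s, hs, z, hz, hal⟩ := hquot a
          -- With a^l = s z, z central, and e^k ∈ S one gets [a, e]^{lk} = [a^l, e^k] = [s, e^k] ∈
          -- S.
          refine ⟨hab e, l * k, Nat.mul_pos hl hk, ?_⟩
          rw [pow_mul, ← commutatorElement_pow_left (hab e)]
          have h1 : ⁅a ^ l, e⁆ ∈ Subgroup.center X := by
            rw [commutatorElement_pow_left (hab e)]; exact pow_mem (hab e) l
          rw [← commutatorElement_pow_right h1, hal, commutatorElement_mul_left]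
          have h2 : ⁅z, e ^ k⁆ = 1 := commutatorElement_eq_one_iff_mul_comm.2
            (Subgroup.mem_center_iff.1 (hZc hz) _).symm
          rw [h2, mul_one, mul_inv_cancel, one_mul, commutatorElement_def]
          exact mul_mem (mul_mem (mul_mem hs hek) (inv_mem hs)) (inv_mem hek)
        | one => rw [commutatorElement_one_right]; exact one_mem _
        | mul b c _ _ hb hc =>
          rw [commutatorElement_mul_right, conj_eq_of_mem_center (hab c)]
          exact mul_mem hb hc
        | inv b _ hb =>
          have h1 := commutatorElement_mul_right a b b⁻¹
          rw [mul_inv_cancel, commutatorElement_one_right, conj_eq_of_mem_center (hab _)] at h1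
          rw [← inv_eq_of_mul_eq_one_right h1.symm]
          exact inv_mem hb
    obtain ⟨k, hk, s, hs, z, hz, hxk⟩ := hquot x
    obtain ⟨hzc, l, hl, hzl⟩ := hZS hz
    refine ⟨k * l, Nat.mul_pos hk hl, ?_⟩
    have hc : Commute s z := Subgroup.mem_center_iff.1 hzc s
    rw [pow_mul, hxk, hc.mul_pow]
    exact mul_mem (pow_mem hs l) hzl

/-- The isolator of a subgroup `S` of a nilpotent group: the subgroup of the elements having a power
in `S`. -/
def isolator {X : Type*} [Group X] [Group.IsNilpotent X] (S : Subgroup X) : Subgroup X where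
  carrier := {x | ∃ k : ℕ, 1 ≤ k ∧ x ^ k ∈ S}
  one_mem' := ⟨1, le_rfl, by simp⟩
  inv_mem' := by
    rintro x ⟨k, hk, hxk⟩
    exact ⟨k, hk, by rw [inv_pow]; exact inv_mem hxk⟩
  mul_mem' := by
    rintro x y hx hy
    -- The generation lemma is applied inside ⟨x, y⟩, which inherits nilpotency.
    set P := Subgroup.closure {x, y} with hP
    have hxP : x ∈ P := Subgroup.subset_closure (by simp)
    have hyP : y ∈ P := Subgroup.subset_closure (by simp)
    obtain ⟨n, hn⟩ := Subgroup.nilpotent_iff_lowerCentralSeries.1 (inferInstance : Group.IsNilpotent P)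
    obtain ⟨k, hk, h⟩ := exists_pow_mem_of_closure_eq_top (S := S.subgroupOf P) hn
      Subgroup.closure_closure_coe_preimage (by
        rintro ⟨e, he'⟩ he
        have he : e = x ∨ e = y := he
        have : ∃ k : ℕ, 1 ≤ k ∧ e ^ k ∈ S := by
          rcases he with h | h <;> rw [h]
          exacts [hx, hy]
        exact this) ⟨x * y, mul_mem hxP hyP⟩
    exact ⟨k, hk, h⟩

end Isolator

/-! ### Functoriality of uniquely divisible closures. -/

namespace IsUniquelyDivisibleClosure

variable {N D E : Type*} [Group N] [Group D] [Group E] {j : N →* D}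

theorem eq_of_pow_eq (hj : IsUniquelyDivisibleClosure j) {x y : D} {k : ℕ} (hk : 1 ≤ k)
    (h : x ^ k = y ^ k) : x = y :=
  (hj.existsUnique_root (y ^ k) k hk).unique h rfl

theorem eq_one_of_pow_eq_one (hj : IsUniquelyDivisibleClosure j) {x : D} {k : ℕ} (hk : 1 ≤ k)
    (h : x ^ k = 1) : x = 1 :=
  hj.eq_of_pow_eq hk (by rw [h, one_pow])

/-- Each x has a power in the image of N, and roots in E are unique. -/
theorem hom_ext (hj : IsUniquelyDivisibleClosure j) {N' : Type*} [Group N'] {j' : N' →* E}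
    (hj' : IsUniquelyDivisibleClosure j') {f g : D →* E} (h : ∀ n, f (j n) = g (j n)) : f = g := by
  ext x
  obtain ⟨k, hk, n, hn⟩ := hj.exists_pow_mem_range x
  refine hj'.eq_of_pow_eq hk ?_
  rw [← map_pow, ← map_pow, ← hn, h]

/-- A homomorphism to a uniquely divisible nilpotent group extends to the uniquely divisible
closure. -/
theorem exists_lift (hj : IsUniquelyDivisibleClosure j) {N' : Type*} [Group N'] {j' : N' →* E}
    (hj' : IsUniquelyDivisibleClosure j') (f : N →* E) : ∃ g : D →* E, ∀ n, g (j n) = f n := by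
  have := hj.nilpotent
  have := hj'.nilpotent
  -- The isolator of the image of N in D × E is the graph of the extension. It is single-valued
  -- because a torsion kernel of j forces e to be torsion, hence trivial, and everywhere defined
  -- because E has roots.
  set H : Subgroup (D × E) := isolator (j.prod f).range with hH
  have hinj : Function.Injective ((MonoidHom.fst D E).comp H.subtype) := by
    refine (injective_iff_map_eq_one _).2 ?_
    rintro ⟨⟨d, e⟩, hde⟩ h1
    obtain rfl : d = 1 := h1
    obtain ⟨k, hk, n, hn⟩ := hde
    have hn1 : j n = 1 := (congrArg Prod.fst hn).trans (one_pow k)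
    have hn2 : f n = e ^ k := congrArg Prod.snd hn
    obtain ⟨l, hl, hnl⟩ := isOfFinOrder_iff_pow_eq_one.1 ((hj.mem_ker_iff n).1 hn1)
    have he : e ^ (k * l) = 1 := by rw [pow_mul, ← hn2, ← map_pow, hnl, map_one]
    obtain rfl := hj'.eq_one_of_pow_eq_one (Nat.mul_pos hk hl) he
    rfl
  have hsurj : Function.Surjective ((MonoidHom.fst D E).comp H.subtype) := by
    intro d
    obtain ⟨k, hk, n, hn⟩ := hj.exists_pow_mem_range d
    obtain ⟨e, he, -⟩ := hj'.existsUnique_root (f n) k hk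
    exact ⟨⟨(d, e), k, hk, n, Prod.ext hn he.symm⟩, rfl⟩
  let σ := MulEquiv.ofBijective _ ⟨hinj, hsurj⟩
  refine ⟨((MonoidHom.snd D E).comp H.subtype).comp σ.symm.toMonoidHom, fun n => ?_⟩
  have hn : σ.symm (j n) = ⟨(j n, f n), 1, le_rfl, n, by simp⟩ := by
    rw [MulEquiv.symm_apply_eq]
    rfl
  change (MonoidHom.snd D E) (H.subtype (σ.symm (j n))) = f n
  rw [hn]
  rfl

end IsUniquelyDivisibleClosure


theorem GroupFiltration.lowerCentralSeries_le {G : Type*} [Group G] (F : GroupFiltration G) (n : ℕ) :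
    (⊤ : Subgroup G).lowerCentralSeries n ≤ F.term n.succPNat := by
  induction n with
  | zero => rw [show Nat.succPNat 0 = 1 from rfl, F.term_one]; exact le_top
  | succ n ih =>
    rw [Subgroup.lowerCentralSeries_succ]
    refine (Subgroup.commutator_mono ih (le_of_eq F.term_one.symm)).trans ?_
    exact F.commutator_le _ _

theorem GroupFiltration.isNilpotent_quotient {G : Type*} [Group G] (F : GroupFiltration G) (i : ℕ+) :
    Group.IsNilpotent (G ⧸ F.term i) := by
  refine Subgroup.nilpotent_iff_lowerCentralSeries.2 ⟨i.natPred, ?_⟩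
  rw [lowerCentralSeries_quotient, Subgroup.map_eq_bot_iff, QuotientGroup.ker_mk']
  have := F.lowerCentralSeries_le i.natPred
  rwa [PNat.succPNat_natPred] at this

/-! ### Quotients of the Malcev completion as uniquely divisible closures. -/

section MalcevCompletion

variable {K : Type*} [Field K] {G : Type*} [Group G] {F : GroupFiltration G}

theorem mem_malcevTerm {i : ℕ+} {x : MalcevCompletion K F} :
    x ∈ malcevTerm K F i ↔ (x : CompletedGroupAlgebra K F) - 1 ∈ (completedFiltration K F).term i :=
  Iff.rfl

theorem IsGroupLike.sub_one_mem {x : CompletedGroupAlgebra K F} (hx : IsGroupLike K F x) :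
    x - 1 ∈ (completedFiltration K F).term 1 := by
  refine AlgFiltration.mem_completionTerm.2 ?_
  rw [map_sub, hx.proj_one, map_one, sub_self]

theorem coe_pow (x : MalcevCompletion K F) (k : ℕ) :
    ((x ^ k : MalcevCompletion K F) : CompletedGroupAlgebra K F) =
      (x : CompletedGroupAlgebra K F) ^ k :=
  rfl

theorem coe_mul_inv (x : MalcevCompletion K F) :
    (x : CompletedGroupAlgebra K F) * (x⁻¹ : MalcevCompletion K F) = 1 := by
  rw [← Submonoid.coe_mul, mul_inv_cancel, Submonoid.coe_one]

theorem coe_inv_mul (x : MalcevCompletion K F) :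
    ((x⁻¹ : MalcevCompletion K F) : CompletedGroupAlgebra K F) * x = 1 := by
  rw [← Submonoid.coe_mul, inv_mul_cancel, Submonoid.coe_one]

theorem mk_eq_mk_iff {i : ℕ+} {x y : MalcevCompletion K F} :
    (x : _ ⧸ malcevTerm K F i) = y ↔
      (x : CompletedGroupAlgebra K F) - y ∈ (completedFiltration K F).term i := by
  rw [eq_comm, QuotientGroup.eq, mem_malcevTerm, Submonoid.coe_mul]
  constructor
  · intro h
    have := (completedFiltration K F).mul_mem_left (y : CompletedGroupAlgebra K F) h
    rwa [mul_sub, ← mul_assoc, coe_mul_inv, one_mul, mul_one] at this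
  · intro h
    have := (completedFiltration K F).mul_mem_left
      ((y⁻¹ : MalcevCompletion K F) : CompletedGroupAlgebra K F) h
    rwa [mul_sub, coe_inv_mul] at this

variable (K F) in
/-- The filtration of the Malcev completion. -/
def malcevFiltration : GroupFiltration (MalcevCompletion K F) where
  term := malcevTerm K F
  antitone _ _ h _ hx := (completedFiltration K F).antitone h hx
  term_one := by
    rw [eq_top_iff]
    exact fun x _ => IsGroupLike.sub_one_mem x.2
  commutator_le i j := Subgroup.commutator_le.2 fun x hx y hy => by
    have h1 := (completedFiltration K F).mul_mem hx hy
    have h2 := (completedFiltration K F).mul_mem hy hx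
    rw [add_comm] at h2
    have h3 := (completedFiltration K F).mul_mem_right
      ((x⁻¹ * y⁻¹ : MalcevCompletion K F) : CompletedGroupAlgebra K F) (sub_mem h1 h2)
    -- With u = x - 1 and v = y - 1: [x, y] - 1 = (xy - yx)(yx)⁻¹ = (uv - vu)(yx)⁻¹.
    have e : ((⁅x, y⁆ : MalcevCompletion K F) : CompletedGroupAlgebra K F) - 1 =
        (((x : CompletedGroupAlgebra K F) - 1) * ((y : CompletedGroupAlgebra K F) - 1) -
          ((y : CompletedGroupAlgebra K F) - 1) * ((x : CompletedGroupAlgebra K F) - 1)) *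
          ((x⁻¹ * y⁻¹ : MalcevCompletion K F) : CompletedGroupAlgebra K F) := by
      have e1 : ((x : CompletedGroupAlgebra K F) - 1) * ((y : CompletedGroupAlgebra K F) - 1) -
          ((y : CompletedGroupAlgebra K F) - 1) * ((x : CompletedGroupAlgebra K F) - 1) =
          ((x * y : MalcevCompletion K F) : CompletedGroupAlgebra K F) -
            ((y * x : MalcevCompletion K F) : CompletedGroupAlgebra K F) := by
        rw [Submonoid.coe_mul, Submonoid.coe_mul]; noncomm_ring
      rw [e1, sub_mul, ← Submonoid.coe_mul, ← Submonoid.coe_mul, ← mul_inv_rev y x,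
        mul_inv_cancel, Submonoid.coe_one, commutatorElement_def, mul_inv_rev]
      simp only [mul_assoc]
    rw [mem_malcevTerm, e, PNat.add_coe]
    exact h3

theorem coe_iota (g : G) : (iota K F g : CompletedGroupAlgebra K F) =
    (groupAlgebraFiltration K F).toCompletion (MonoidAlgebra.of K G g) :=
  rfl

theorem iota_mem_malcevTerm_iff {i : ℕ+} {g : G} : iota K F g ∈ malcevTerm K F i ↔
    MonoidAlgebra.of K G g - 1 ∈ (groupAlgebraFiltration K F).term i := by
  rw [mem_malcevTerm, coe_iota, ← map_one (groupAlgebraFiltration K F).toCompletion, ← map_sub]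
  exact AlgFiltration.toCompletion_mem_iff

/-- Continuity of the diagonal x ↦ x ⊗̂ x, from x ⊗ x - y ⊗ y = (x - y) ⊗ x + y ⊗ (x - y). -/
theorem completedTmul_sub_completedTmul_mem {n : ℕ} {x y : CompletedGroupAlgebra K F}
    (h : x - y ∈ (completedFiltration K F).term n) :
    completedTmul K F x x - completedTmul K F y y ∈
      ((completedFiltration K F).tensor (completedFiltration K F)).completionFiltration.term n := by
  have e : x ⊗ₜ[K] x - y ⊗ₜ[K] y = (x - y) ⊗ₜ[K] x + y ⊗ₜ[K] (x - y) := by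
    rw [TensorProduct.sub_tmul, TensorProduct.tmul_sub]; abel
  rw [completedTmul, completedTmul, ← map_sub, e]
  exact AlgFiltration.toCompletion_mem (add_mem
    (AlgFiltration.tmul_mem_tensorTerm (add_zero n) h (AlgFiltration.mem_term_zero _ _))
    (AlgFiltration.tmul_mem_tensorTerm (zero_add n) (AlgFiltration.mem_term_zero _ _) h))

theorem completedComul_mem {n : ℕ} {x : CompletedGroupAlgebra K F}
    (h : x ∈ (completedFiltration K F).term n) : completedComul K F x ∈
      ((completedFiltration K F).tensor (completedFiltration K F)).completionFiltration.term n :=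
  AlgFiltration.completionMap_mem (comulToCompleted_mem K F) h

theorem completedTmul_pow (x y : CompletedGroupAlgebra K F) (k : ℕ) :
    completedTmul K F x y ^ k = completedTmul K F (x ^ k) (y ^ k) := by
  induction k with
  | zero => rw [pow_zero, pow_zero, pow_zero, completedTmul_one]
  | succ k ih => rw [pow_succ, pow_succ, pow_succ, ih, completedTmul_mul]

/-- Group-like elements have group-like roots. -/
theorem exists_pow_eq [CharZero K] (x : MalcevCompletion K F) {k : ℕ} (hk : 1 ≤ k) :
    ∃ y : MalcevCompletion K F, y ^ k = x := by
  obtain ⟨x, hx⟩ := x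
  replace hx : IsGroupLike K F x := hx
  obtain ⟨y, hy, rfl⟩ := AlgFiltration.exists_root _ hk hx.sub_one_mem
  refine ⟨⟨y, ?_, ?_⟩, rfl⟩
  -- The coproduct of y and y ⊗̂ y are both congruent to 1 and have the same k-th power, so they
  -- agree by uniqueness of roots.
  · refine AlgFiltration.eq_of_pow_eq_pow _ hk ?_ ?_ ?_
    · have := completedComul_mem hy
      rwa [map_sub, map_one] at this
    · have := completedTmul_sub_completedTmul_mem hy
      rwa [completedTmul_one] at this
    · rw [← map_pow, hx.1, completedTmul_pow]
  · rintro rfl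
    exact hx.2 (zero_pow (by omega))

/-- Elements of the completed group algebra which are approximated by group-like elements are
group-like. -/
theorem IsGroupLike.of_forall_exists {x : CompletedGroupAlgebra K F}
    (h : ∀ n : ℕ, ∃ y, IsGroupLike K F y ∧ x - y ∈ (completedFiltration K F).term n) :
    IsGroupLike K F x := by
  constructor
  · refine AlgFiltration.eq_of_forall_sub_mem _ fun n => ?_
    obtain ⟨y, hy, hxy⟩ := h n
    have h1 := completedComul_mem hxy
    rw [map_sub, hy.1] at h1
    have := sub_mem h1 (completedTmul_sub_completedTmul_mem hxy)
    rwa [sub_sub_sub_cancel_right] at this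
  -- If 0 were approximated by a group-like element, -1 would lie in F_1, against ε(1) = 1.
  · rintro rfl
    obtain ⟨y, hy, hxy⟩ := h 1
    have := add_mem hxy hy.sub_one_mem
    rw [sub_add_sub_cancel, zero_sub] at this
    have h1 := AlgFiltration.mem_completionTerm.1 this
    have h2 := proj_one_eq K F (-1)
    rw [h1, map_neg, map_one, neg_smul, one_smul, eq_comm, neg_eq_zero,
      ← map_one (Ideal.Quotient.mkₐ K ((groupAlgebraFiltration K F).ideal 1)),
      AlgFiltration.mk_eq_zero] at h2
    have := counit_eq_zero K F 1 h2
    rw [map_one] at this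
    exact one_ne_zero this

/-- The representative of an element of the `i`-th term of the Malcev completion is primitive in the
associated graded algebra. -/
theorem exists_mem_liePart_of_mem_malcevTerm [CharZero K] {i : ℕ+} {z : MalcevCompletion K F}
    (hz : z ∈ malcevTerm K F i) : ∃ a ∈ liePart K F i, a ∈ (groupAlgebraFiltration K F).term i ∧
      (z : CompletedGroupAlgebra K F) - 1 - (groupAlgebraFiltration K F).toCompletion a ∈
        (completedFiltration K F).term (i + 1) := by
  set C := groupAlgebraFiltration K F with hC
  have hi := i.pos
  obtain ⟨a, ha⟩ := AlgFiltration.exists_sub_toCompletion_mem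
    ((z : CompletedGroupAlgebra K F) - 1) (i + 1)
  have hai : a ∈ C.term i := by
    rw [← AlgFiltration.toCompletion_mem_iff]
    have := sub_mem (mem_malcevTerm.1 hz) ((completedFiltration K F).antitone (Nat.le_add_right (i : ℕ) 1) ha)
    rwa [sub_sub_cancel] at this
  refine ⟨a, mem_liePart_of_primitive hi hai ?_, hai, ha⟩
  have hz1 : (z : CompletedGroupAlgebra K F) - C.toCompletion (1 + a) ∈
      (completedFiltration K F).term (i + 1) := by
    rw [map_add, map_one, ← sub_sub]
    exact ha
  have h1 := completedComul_mem hz1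
  have hcm : completedComul K F (C.toCompletion (1 + a)) =
      ((completedFiltration K F).tensor (completedFiltration K F)).toCompletion
        (comulToCompleted K F (1 + a)) :=
    AlgFiltration.completionMap_toCompletion (comulToCompleted_mem K F) _
  have hzg : IsGroupLike K F (z : CompletedGroupAlgebra K F) := z.2
  rw [map_sub, hzg.1, hcm] at h1
  have h2 := sub_mem (completedTmul_sub_completedTmul_mem hz1) h1
  rw [sub_sub_sub_cancel_left, completedTmul, ← map_sub, AlgFiltration.toCompletion_mem_iff] at h2
  have h3 : Bialgebra.comulAlgHom K (MonoidAlgebra K G) (1 + a) - (1 + a) ⊗ₜ[K] (1 + a) ∈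
      (C.tensor C).term (i + 1) := by
    refine AlgFiltration.mem_tensor_of_map_toCompletion_mem ?_
    rw [map_sub, Algebra.TensorProduct.map_tmul]
    exact h2
  -- The quadratic part of (1 + a) ⊗ (1 + a) has degree 2i ≥ i + 1, so being group-like becomes
  -- being primitive.
  have h4 : a ⊗ₜ[K] a ∈ (C.tensor C).term (i + 1) :=
    AlgFiltration.antitone _ (by omega) (AlgFiltration.tmul_mem_tensorTerm rfl hai hai)
  have := add_mem h3 h4
  convert this using 1
  rw [map_add, map_one, TensorProduct.add_tmul, TensorProduct.tmul_add, TensorProduct.tmul_add,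
    Algebra.TensorProduct.one_def]
  abel

/-- Up to powers, the associated graded group of the Malcev completion comes from the group. -/
theorem exists_pow_sub_iota_mem {i : ℕ+} {z : MalcevCompletion ℚ F} (hz : z ∈ malcevTerm ℚ F i) :
    ∃ (m : ℕ) (h : G), 1 ≤ m ∧
      ((z ^ m : MalcevCompletion ℚ F) : _ ⧸ malcevTerm ℚ F (i + 1)) = iota ℚ F h := by
  obtain ⟨a, ha, hai, hza⟩ := exists_mem_liePart_of_mem_malcevTerm hz
  obtain ⟨m, h, hm, hh, hmh⟩ := exists_nsmul_sub_mem_of_mem_liePart ha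
  refine ⟨m, h, hm, mk_eq_mk_iff.2 ?_⟩
  -- Linearise the power at b = 1: z^m - 1 ≡ m(z - 1) modulo F_{i+1}.
  have h1 := (completedFiltration ℚ F).pow_sub_pow_sub_mem (IsGroupLike.sub_one_mem z.2)
    (b := 1) (by simp) hz m
  have h2 := Submodule.smul_mem _ (m : ℚ) hza
  have h3 := AlgFiltration.toCompletion_mem hmh
  have := add_mem (add_mem h1 h2) h3
  rw [PNat.add_coe, PNat.one_coe, coe_pow, coe_iota]
  convert this using 1
  rw [map_sub, map_sub, map_smul, map_one, one_pow, smul_sub (m : ℚ) _ (AlgFiltration.toCompletion _ a)]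
  abel

/-- Up to powers and modulo the terms of the filtration, the elements of the Malcev completion come
from the group. -/
theorem exists_pow_eq_iota (x : MalcevCompletion ℚ F) (i : ℕ+) : ∃ (k : ℕ) (g : G), 1 ≤ k ∧
    ((x ^ k : MalcevCompletion ℚ F) : _ ⧸ malcevTerm ℚ F i) = iota ℚ F g := by
  induction i using PNat.recOn with
  | one =>
    refine ⟨1, 1, le_rfl, ?_⟩
    rw [map_one, pow_one, QuotientGroup.mk_one, QuotientGroup.eq_one_iff]
    exact IsGroupLike.sub_one_mem x.2
  | succ i ih =>
    obtain ⟨k, g, hk, hxg⟩ := ih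
    set z := (iota ℚ F g)⁻¹ * x ^ k with hz
    have hzi : z ∈ malcevTerm ℚ F i := QuotientGroup.eq.1 hxg.symm
    obtain ⟨m, h, hm, hzm⟩ := exists_pow_sub_iota_mem hzi
    refine ⟨k * m, g ^ m * h, Nat.mul_pos hk hm, ?_⟩
    -- Since [F_1, F_i] ⊆ F_{i+1}, the correction z is central modulo F_{i+1}, so powers of ι(g) z
    -- can be computed factorwise.
    have hc : Commute (iota ℚ F g : _ ⧸ malcevTerm ℚ F (i + 1)) z := by
      rw [← commutatorElement_eq_one_iff_commute]
      have := (malcevFiltration ℚ F).commutator_le 1 i (Subgroup.commutator_mem_commutator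
        (g₁ := iota ℚ F g) (by rw [(malcevFiltration ℚ F).term_one]; trivial) hzi)
      rw [add_comm] at this
      exact (QuotientGroup.eq_one_iff _).2 this
    have hxk : x ^ k = iota ℚ F g * z := by rw [hz, mul_inv_cancel_left]
    rw [pow_mul, hxk, QuotientGroup.mk_pow, QuotientGroup.mk_mul, hc.mul_pow, ← QuotientGroup.mk_pow,
      ← QuotientGroup.mk_pow, hzm, ← QuotientGroup.mk_mul, map_mul, map_pow]

variable (F) in
/-- The homomorphism from `G / F i` to the quotient of the Malcev completion by `F i`. -/
def iotaQuotient (i : ℕ+) : G ⧸ F.term i →* MalcevCompletion ℚ F ⧸ malcevTerm ℚ F i :=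
  QuotientGroup.map _ _ (iota ℚ F) fun _ hg => iota_mem_malcevTerm_iff.2 (of_sub_one_mem ℚ hg)

theorem iotaQuotient_mk (i : ℕ+) (g : G) : iotaQuotient F i g = iota ℚ F g :=
  rfl

/-- The quotients of the Malcev completion are uniquely divisible closures of the quotients of the
group. -/
theorem isUniquelyDivisibleClosure_iotaQuotient (i : ℕ+) :
    IsUniquelyDivisibleClosure (iotaQuotient F i) where
  nilpotent := (malcevFiltration ℚ F).isNilpotent_quotient i
  existsUnique_root y k hk := by
    obtain ⟨y, rfl⟩ := QuotientGroup.mk_surjective y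
    obtain ⟨x, rfl⟩ := exists_pow_eq y hk
    refine ⟨x, rfl, fun x' hx' => ?_⟩
    obtain ⟨x', rfl⟩ := QuotientGroup.mk_surjective x'
    rw [mk_eq_mk_iff]
    rw [← QuotientGroup.mk_pow, mk_eq_mk_iff, coe_pow, coe_pow] at hx'
    exact (completedFiltration ℚ F).sub_mem_of_pow_sub_pow_mem hk (IsGroupLike.sub_one_mem x'.2)
      (IsGroupLike.sub_one_mem x.2) hx'
  mem_ker_iff n := by
    obtain ⟨g, rfl⟩ := QuotientGroup.mk_surjective n
    rw [MonoidHom.mem_ker, iotaQuotient_mk, QuotientGroup.eq_one_iff, iota_mem_malcevTerm_iff,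
      isOfFinOrder_iff_pow_eq_one]
    constructor
    · intro h
      obtain ⟨k, hk, hgk⟩ := exists_pow_mem_term h
      exact ⟨k, hk, (QuotientGroup.eq_one_iff _).2 hgk⟩
    · rintro ⟨k, hk, hgk⟩
      rw [← QuotientGroup.mk_pow, QuotientGroup.eq_one_iff] at hgk
      -- Conversely, uniqueness of roots modulo F_i shows that torsion of G/F_iG dies in M/F_iM.
      refine AlgFiltration.sub_one_mem_of_pow _ hk
        (of_sub_one_mem (i := 1) ℚ (by simp [F.term_one])) ?_
      rw [← map_pow]
      exact of_sub_one_mem ℚ hgk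
  exists_pow_mem_range x := by
    obtain ⟨x, rfl⟩ := QuotientGroup.mk_surjective x
    obtain ⟨k, g, hk, h⟩ := exists_pow_eq_iota x i
    exact ⟨k, hk, g, h.symm⟩

theorem eq_of_forall_mk_eq {x y : MalcevCompletion K F}
    (h : ∀ i : ℕ+, (x : _ ⧸ malcevTerm K F i) = y) : x = y := by
  refine Subtype.ext (AlgFiltration.eq_of_forall_sub_mem _ fun n => ?_)
  exact (completedFiltration K F).antitone (Nat.le_succ n) (mk_eq_mk_iff.1 (h n.succPNat))

/-- The Malcev completion is complete. -/
theorem exists_forall_mk_eq (y : ℕ+ → MalcevCompletion K F)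
    (hy : ∀ i k : ℕ+, i ≤ k → (y k : _ ⧸ malcevTerm K F i) = y i) :
    ∃ x : MalcevCompletion K F, ∀ i : ℕ+, (x : _ ⧸ malcevTerm K F i) = y i := by
  obtain ⟨x, hx⟩ := AlgFiltration.exists_limit (groupAlgebraFiltration K F)
    (fun n => (y n.succPNat : CompletedGroupAlgebra K F)) fun n =>
      (completedFiltration K F).antitone (Nat.le_succ n)
        (mk_eq_mk_iff.1 (hy n.succPNat (n + 1).succPNat (Nat.succPNat_le_succPNat.2 n.le_succ)))
  refine ⟨⟨x, IsGroupLike.of_forall_exists fun n => ⟨_, (y n.succPNat).2, hx n⟩⟩, fun i => ?_⟩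
  have h1 : (y (i : ℕ).succPNat : _ ⧸ malcevTerm K F i) = y i := hy _ _ (Nat.le_succ (i : ℕ))
  rw [← h1]
  exact mk_eq_mk_iff.2 (hx i)

end MalcevCompletion


/-! ### Passage to the inverse limit. -/

section InverseLimit

variable {G : Type u} [Group G] {F : GroupFiltration G} {D : ℕ+ → Type v} [∀ i, Group (D i)]
  {j : ∀ i : ℕ+, G ⧸ F.term i →* D i}

theorem existsUnique_transition (hj : ∀ i, IsUniquelyDivisibleClosure (j i)) :
    ∃! t : ∀ i k : ℕ+, i ≤ k → (D k →* D i),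
      ∀ (i k : ℕ+) (h : i ≤ k) (g : G), t i k h (j k g) = j i g := by
  have key : ∀ (i k : ℕ+) (h : i ≤ k), ∃ f : D k →* D i, ∀ n, f (j k n) =
      (j i).comp (QuotientGroup.map (F.term k) (F.term i) (MonoidHom.id G) (F.antitone h)) n :=
    fun i k h => (hj k).exists_lift (hj i) _
  choose t ht using key
  refine ⟨t, fun i k h g => ht i k h g, fun t' ht' => ?_⟩
  funext i k h
  refine (hj k).hom_ext (hj i) fun n => ?_
  induction n using QuotientGroup.induction_on with
  | H g => exact (ht' i k h g).trans (ht i k h g).symm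

theorem existsUnique_toMalcevQuotient (hj : ∀ i, IsUniquelyDivisibleClosure (j i)) :
    ∃! φ : ∀ i : ℕ+, D i →* MalcevCompletion ℚ F ⧸ malcevTerm ℚ F i,
      ∀ (i : ℕ+) (g : G), φ i (j i g) = (iota ℚ F g : _ ⧸ malcevTerm ℚ F i) := by
  choose φ hφ using fun i =>
    (hj i).exists_lift (isUniquelyDivisibleClosure_iotaQuotient i) (iotaQuotient F i)
  refine ⟨φ, fun i g => hφ i g, fun φ' hφ' => ?_⟩
  funext i
  refine (hj i).hom_ext (isUniquelyDivisibleClosure_iotaQuotient i) fun n => ?_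
  induction n using QuotientGroup.induction_on with
  | H g => exact (hφ' i g).trans (hφ i g).symm

/-- Uniquely divisible closures are isomorphic to the quotients of the Malcev completion. -/
theorem bijective_toMalcevQuotient {i : ℕ+} {D : Type v} [Group D] {j : G ⧸ F.term i →* D}
    (hj : IsUniquelyDivisibleClosure j) {φ : D →* MalcevCompletion ℚ F ⧸ malcevTerm ℚ F i}
    (hφ : ∀ g : G, φ (j g) = (iota ℚ F g : _ ⧸ malcevTerm ℚ F i)) : Function.Bijective φ := by
  have hι := isUniquelyDivisibleClosure_iotaQuotient (F := F) i
  obtain ⟨ψ, hψ⟩ := hι.exists_lift hj j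
  have h1 : ψ.comp φ = MonoidHom.id D := hj.hom_ext hj fun n => by
    induction n using QuotientGroup.induction_on with
    | H g => exact (congrArg ψ (hφ g)).trans (hψ g)
  have h2 : φ.comp ψ = MonoidHom.id _ := hι.hom_ext hι fun n => by
    induction n using QuotientGroup.induction_on with
    | H g => exact (congrArg φ (hψ g)).trans (hφ g)
  exact ⟨Function.LeftInverse.injective (DFunLike.congr_fun h1),
    Function.RightInverse.surjective (DFunLike.congr_fun h2)⟩

/-- The φ_i are isomorphisms compatible with the projections, so the limit of the D_i is that of the
M/F_iM, which is M by completeness and separation. -/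
theorem existsUnique_inverseLimit_equiv (hj : ∀ i, IsUniquelyDivisibleClosure (j i))
    {t : ∀ i k : ℕ+, i ≤ k → (D k →* D i)}
    {φ : ∀ i : ℕ+, D i →* MalcevCompletion ℚ F ⧸ malcevTerm ℚ F i}
    (ht : ∀ (i k : ℕ+) (h : i ≤ k) (g : G), t i k h (j k g) = j i g)
    (hφ : ∀ (i : ℕ+) (g : G), φ i (j i g) = (iota ℚ F g : _ ⧸ malcevTerm ℚ F i)) :
    ∃! Φ : inverseLimit t ≃* MalcevCompletion ℚ F,
      (∀ (x : inverseLimit t) (i : ℕ+), (Φ x : _ ⧸ malcevTerm ℚ F i) = φ i (x.1 i)) ∧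
      ∀ (x : inverseLimit t) (g : G), (∀ i, x.1 i = j i g) → Φ x = iota ℚ F g := by
  have hbij := fun i => bijective_toMalcevQuotient (hj i) (hφ i)
  let π : ∀ i k : ℕ+, i ≤ k →
      (MalcevCompletion ℚ F ⧸ malcevTerm ℚ F k →* MalcevCompletion ℚ F ⧸ malcevTerm ℚ F i) :=
    fun i k h => QuotientGroup.map _ _ (MonoidHom.id _) ((malcevFiltration ℚ F).antitone h)
  have hπ : ∀ (i k : ℕ+) (h : i ≤ k) (d : D k), φ i (t i k h d) = π i k h (φ k d) := by
    intro i k h d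
    have : (φ i).comp (t i k h) = (π i k h).comp (φ k) := by
      refine (hj k).hom_ext (isUniquelyDivisibleClosure_iotaQuotient i) fun n => ?_
      induction n using QuotientGroup.induction_on with
      | H g =>
        simp only [MonoidHom.comp_apply]
        rw [ht, hφ, hφ]
        rfl
    exact DFunLike.congr_fun this d
  let e := fun i => MulEquiv.ofBijective (φ i) (hbij i)
  have he : ∀ i y, φ i ((e i).symm y) = y := fun i y => (e i).apply_symm_apply y
  -- The inverse of Φ is written down directly from the projections of M; completeness is needed
  -- only for its surjectivity.
  let Ψ : MalcevCompletion ℚ F →* inverseLimit t :=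
    { toFun := fun m => ⟨fun i => (e i).symm (m : _ ⧸ malcevTerm ℚ F i), fun i k h =>
        (hbij i).1 (by rw [hπ, he, he]; rfl)⟩
      map_one' := Subtype.ext (funext fun i => map_one (e i).symm)
      map_mul' := fun m m' => Subtype.ext (funext fun i =>
        map_mul (e i).symm (m : _ ⧸ malcevTerm ℚ F i) (m' : _ ⧸ malcevTerm ℚ F i)) }
  have hΨ : ∀ m i, φ i ((Ψ m).1 i) = (m : _ ⧸ malcevTerm ℚ F i) := fun m i => he i _
  have hΨbij : Function.Bijective Ψ := by
    constructor
    · intro m m' h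
      refine eq_of_forall_mk_eq fun i => ?_
      rw [← hΨ, ← hΨ, h]
    · intro x
      choose y hy using fun i => QuotientGroup.mk_surjective (φ i (x.1 i))
      obtain ⟨m, hm⟩ := exists_forall_mk_eq y fun i k h => by
        rw [hy, ← x.2 i k h, hπ, ← hy]
        rfl
      exact ⟨m, Subtype.ext (funext fun i => (hbij i).1 (by rw [hΨ, hm, hy]))⟩
  let Φ := (MulEquiv.ofBijective Ψ hΨbij).symm
  have hΦ : ∀ (x : inverseLimit t) (i : ℕ+), (Φ x : _ ⧸ malcevTerm ℚ F i) = φ i (x.1 i) := by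
    intro x i
    obtain ⟨m, rfl⟩ := hΨbij.2 x
    have : Φ (Ψ m) = m := (MulEquiv.ofBijective Ψ hΨbij).symm_apply_apply m
    rw [this, hΨ]
  refine ⟨Φ, ⟨hΦ, fun x g hx => ?_⟩, fun Φ' hΦ' => ?_⟩
  · refine eq_of_forall_mk_eq fun i => ?_
    rw [hΦ, hx, hφ]
  -- The congruences modulo all F_iM already determine Φ, because M is separated.
  · ext1 x
    refine eq_of_forall_mk_eq fun i => ?_
    rw [hΦ, hΦ'.1]

end InverseLimit

end Malcev

end

theorem theoremA10 {G : Type u} [Group G] (F : Malcev.GroupFiltration G) :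
    -- the uniquely divisible closures of the quotients `G / F_i G` exist,
    (∀ i : ℕ+, ∃ (D : Type u) (_ : Group D) (j : G ⧸ F.term i →* D),
      Malcev.IsUniquelyDivisibleClosure j) ∧
    -- and for every choice `j i : G / F_i G → D i` of these closures:
    ∀ (D : ℕ+ → Type v) [∀ i, Group (D i)] (j : ∀ i : ℕ+, G ⧸ F.term i →* D i),
      (∀ i, Malcev.IsUniquelyDivisibleClosure (j i)) →
      -- the projections `G / F_k G → G / F_i G` extend uniquely to the closures,
      (∃! t : ∀ i k : ℕ+, i ≤ k → (D k →* D i),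
        ∀ (i k : ℕ+) (h : i ≤ k) (g : G), t i k h (j k g) = j i g) ∧
      -- `ι` induces unique homomorphisms `D i → M / F_i M` (`M` the Malcev completion of `G`),
      (∃! φ : ∀ i : ℕ+, D i →* Malcev.MalcevCompletion ℚ F ⧸ Malcev.malcevTerm ℚ F i,
        ∀ (i : ℕ+) (g : G), φ i (j i g) = (Malcev.iota ℚ F g : _ ⧸ Malcev.malcevTerm ℚ F i)) ∧
      -- and these induce an isomorphism from the inverse limit of the `D i` to `M`.
      ∀ (t : ∀ i k : ℕ+, i ≤ k → (D k →* D i))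
        (φ : ∀ i : ℕ+, D i →* Malcev.MalcevCompletion ℚ F ⧸ Malcev.malcevTerm ℚ F i),
        (∀ (i k : ℕ+) (h : i ≤ k) (g : G), t i k h (j k g) = j i g) →
        (∀ (i : ℕ+) (g : G),
          φ i (j i g) = (Malcev.iota ℚ F g : _ ⧸ Malcev.malcevTerm ℚ F i)) →
        ∃! Φ : Malcev.inverseLimit t ≃* Malcev.MalcevCompletion ℚ F,
          (∀ (x : Malcev.inverseLimit t) (i : ℕ+),
            (Φ x : _ ⧸ Malcev.malcevTerm ℚ F i) = φ i (x.1 i)) ∧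
          ∀ (x : Malcev.inverseLimit t) (g : G), (∀ i, x.1 i = j i g) →
            Φ x = Malcev.iota ℚ F g := by
  -- M/F_iM itself serves as a closure of G/F_iG.
  refine ⟨fun i => ⟨_, inferInstance, Malcev.iotaQuotient F i,
    Malcev.isUniquelyDivisibleClosure_iotaQuotient i⟩, fun D _ j hj => ?_⟩
  exact ⟨Malcev.existsUnique_transition hj, Malcev.existsUnique_toMalcevQuotient hj,
    fun t φ ht hφ => Malcev.existsUnique_inverseLimit_equiv hj ht hφ⟩
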